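/- **Setting.** Treeplexes are the sets built recursively from probability simplexes by Cartesian products and branchings $\mathcal Z_1\,\boxed{i}\,\mathcal Z_2=\{(u,u_i v):u\in\mathcal Z_1,v\in\mathcal Z_2\}$; each simplex used is an information set $h$, with index set $\Omega_h$ and parent index $\sigma(h)$ ($z_{\sigma(h)}:=1$ if there is no parent). Let $\mathcal X\subset\mathbb R^M$, $\mathcal Y\subset\mathbb R^N$ be treeplexes, $\mathcal Z=\mathcal X\times\mathcal Y$, $P=M+N$, $A\in[-1,1]^{M\times N}$, $F(x,y)=(Ay,-A^\top x)$, and let $\mathcal Z^*$ be the set of Nash equilibria of $\min_{x\in\mathcal X}\max_{y\in\mathcal Y}x^\top Ay$. Let $$\psi^{\mathcal Z}(z)=\sum_h\alpha_h z_{\sigma(h)}\psi_h(z_h/z_{\sigma(h)}),\qquad \alpha_h\ge 0,$$ be a dilated regularizer that is 1-strongly convex, $D_{\psi^{\mathcal Z}}(z,z')\ge\frac12\|z-z'\|_2^2$. The base regularizers $\psi_h$ are continuous and strongly convex on the simplex, differentiable in its relative interior and at every minimizer over the simplex of $\psi_h$ plus a linear function (for example the negative entropy or the squared Euclidean norm).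 **Algorithm.** Fix a stepsize $0<\eta\le\frac1{8P}$, $\tau_0\in(0,1]$, and set $\tau_k=\tau_0/2^k$. Episode $k=0,1,2,\dots$ starts from $z_0=\hat z_1=$ the uniform strategy and performs, for $r=1,\dots,L_k$, $$z_r=\arg\min_{z\in\mathcal Z}\langle z,F(z_{r-1})+\tau_k\nabla\psi^{\mathcal Z}(\hat z_r)\rangle+\tfrac1\eta D_{\psi^{\mathcal Z}}(z,\hat z_r),\qquad \hat z_{r+1}=\arg\min_{z\in\mathcal Z}\langle z,F(z_r)+\tau_k\nabla\psi^{\mathcal Z}(\hat z_r)\rangle+\tfrac1\eta D_{\psi^{\mathcal Z}}(z,\hat z_r).$$ Iterates carry their local strategies $q_h$ ($=z_h/z_{\sigma(h)}$ where $z_{\sigma(h)}>0$); below information sets reached with probability $0$ these are the local strategies given by the bottom-up solution of the minimization, and $\nabla\psi^{\mathcal Z}$, $D_{\psi^{\mathcal Z}}$ are written through them. The lengths are of order $\tilde\Theta(1/\tau_k)$: with $b_k=\frac{2}{\eta\tau_k}\log\frac1{\tau_k}$, $$\max(1,b_k)\le L_k\le\frac{c}{\tau_k}\Big(1+\log\frac1{\tau_k}\Big)^p$$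 for a constant $c$ and an integer $p\ge 0$. Write $\hat z^{(k)}_{r+1}$ for the iterate after iteration $r$ of episode $k$, which is iteration $t=L_0+\dots+L_{k-1}+r$ of the run. **Theorem.** There is a constant $C$, depending only on $\mathcal X,\mathcal Y,(\psi_h),\alpha,\eta,\tau_0,c,p$, and for every $A$ a constant $C'$ depending in addition only on $A$, such that, for all such lengths and every such run, the following holds for all $k\ge0$, $1\le r\le L_k$ and $t=L_0+\dots+L_{k-1}+r$. If $k=0$ or $r\ge b_k$ (in particular at the end $r=L_k$ of every episode), the last iterate $\hat z=\hat z^{(k)}_{r+1}$ satisfies $$\max_{z\in\mathcal Z}F(\hat z)^\top(\hat z-z)\le C\,\frac{(1+\log t)^p}{t},\qquad \Big\|\hat z-\prod\nolimits_{\mathcal Z^*}(\hat z)\Big\|_2\le C'\,\frac{(1+\log t)^p}{t},$$ where $\prod_{\mathcal Z^*}$ is the Euclidean projection onto $\mathcal Z^*$. If $k\ge1$, then for every $1\le r\le L_k$ the same bounds, with the same $t$, hold for the final iterate $\hat z=\hat z^{(k-1)}_{L_{k-1}+1}$ of the preceding episode. Uniqueness of the Nash equilibrium is not assumed. -/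

import Mathlib

noncomputable section

/-- Treeplexes in `ℝⁿ`, built recursively from probability simplexes, Cartesian products
(binary products generate all finite ones) and branchings `S [i] T`. -/
inductive Treeplex : ℕ → Type
  | simplex (m : ℕ) : Treeplex (m + 1)
  | prod {m n : ℕ} (S : Treeplex m) (T : Treeplex n) : Treeplex (m + n)
  | branch {m n : ℕ} (S : Treeplex m) (i : Fin m) (T : Treeplex n) : Treeplex (m + n)

namespace Treeplex

/-- The set of sequence-form strategies: the treeplex as a subset of `ℝⁿ`. -/
def carrier : {n : ℕ} → Treeplex n → Set (Fin n → ℝ)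
  | _, simplex m => stdSimplex ℝ (Fin (m + 1))
  | _, prod S T => {z | ∃ u ∈ S.carrier, ∃ v ∈ T.carrier, z = Fin.append u v}
  | _, branch S i T => {z | ∃ u ∈ S.carrier, ∃ v ∈ T.carrier, z = Fin.append u (u i • v)}

/-- The information sets, one for each simplex used in the construction. -/
def Infoset : {n : ℕ} → Treeplex n → Type
  | _, simplex _ => Unit
  | _, prod S T => S.Infoset ⊕ T.Infoset
  | _, branch S _ T => S.Infoset ⊕ T.Infoset

@[reducible] def infosetFintype : {n : ℕ} → (T : Treeplex n) → Fintype T.Infoset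
  | _, simplex _ => inferInstanceAs (Fintype Unit)
  | _, prod S T =>
    letI := S.infosetFintype
    letI := T.infosetFintype
    inferInstanceAs (Fintype (S.Infoset ⊕ T.Infoset))
  | _, branch S _ T =>
    letI := S.infosetFintype
    letI := T.infosetFintype
    inferInstanceAs (Fintype (S.Infoset ⊕ T.Infoset))

@[reducible] def infosetDecidableEq : {n : ℕ} → (T : Treeplex n) → DecidableEq T.Infoset
  | _, simplex _ => inferInstanceAs (DecidableEq Unit)
  | _, prod S T =>
    letI := S.infosetDecidableEq
    letI := T.infosetDecidableEq
    inferInstanceAs (DecidableEq (S.Infoset ⊕ T.Infoset))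
  | _, branch S _ T =>
    letI := S.infosetDecidableEq
    letI := T.infosetDecidableEq
    inferInstanceAs (DecidableEq (S.Infoset ⊕ T.Infoset))

instance {n : ℕ} (T : Treeplex n) : Fintype T.Infoset := T.infosetFintype

instance {n : ℕ} (T : Treeplex n) : DecidableEq T.Infoset := T.infosetDecidableEq

/-- `h(i)`: the information set to which the index `i` belongs. -/
def infoset : {n : ℕ} → (T : Treeplex n) → Fin n → T.Infoset
  | _, simplex _ => fun _ => ()
  | _, prod S T => Fin.append (fun i => Sum.inl (S.infoset i)) (fun i => Sum.inr (T.infoset i))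
  | _, branch S _ T =>
    Fin.append (fun i => Sum.inl (S.infoset i)) (fun i => Sum.inr (T.infoset i))

/-- `σ(h)`: the index of the parent variable of `h`; `none` stands for "no parent"
(`σ(h) = 0` in the usual notation). -/
def parent : {n : ℕ} → (T : Treeplex n) → T.Infoset → Option (Fin n)
  | _, simplex _ => fun _ => none
  | _, prod (m := m) (n := n) S T =>
    Sum.elim (fun h => (S.parent h).map (Fin.castAdd n)) (fun h => (T.parent h).map (Fin.natAdd m))
  | _, branch (m := m) (n := n) S i T =>
    Sum.elim (fun h => (S.parent h).map (Fin.castAdd n))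
      (fun h => some ((T.parent h).elim (Fin.castAdd n i) (Fin.natAdd m)))

variable {n : ℕ} (T : Treeplex n)

/-- `Ω_h`: the indices that belong to the information set `h`. -/
abbrev Omega (h : T.Infoset) : Type := {i : Fin n // T.infoset i = h}

/-- `z_{σ(h)}`, equal to `1` if `h` has no parent. -/
def reach (z : Fin n → ℝ) (h : T.Infoset) : ℝ := (T.parent h).elim 1 z

/-- A strategy: its sequence form `z` (`seq`) together with the local strategies `q` (`loc`),
`z_i = q_i z_{σ(h(i))}`. Where `z_{σ(h)} > 0`, `q_h = z_h / z_{σ(h)}` is determined by `z`;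
at information sets that are reached with probability `0` it is additional data. -/
structure Strategy where
  seq : Fin n → ℝ
  loc : Fin n → ℝ
  seq_mem : seq ∈ T.carrier
  loc_mem : ∀ h : T.Infoset, (fun i : T.Omega h => loc i.1) ∈ stdSimplex ℝ (T.Omega h)
  seq_eq : ∀ i, seq i = loc i * T.reach seq (T.infoset i)

variable {T}

/-- `q_h`: the local strategy at the information set `h`, a point of the simplex over `Ω_h`. -/
def Strategy.locAt (s : T.Strategy) (h : T.Infoset) : T.Omega h → ℝ := fun i => s.loc i.1

/-- The uniform strategy: every `q_h` is the uniform distribution on `Ω_h`. -/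
def Strategy.IsUniform (s : T.Strategy) : Prop :=
  ∀ i, s.loc i = 1 / (Fintype.card (T.Omega (T.infoset i)) : ℝ)

end Treeplex

/-- The Bregman divergence `D_ψ(u, v) = ψ(u) - ψ(v) - ⟨∇ψ(v), u - v⟩`. -/
def bregman {κ : Type} [Fintype κ] (ψ : (κ → ℝ) → ℝ) (u v : κ → ℝ) : ℝ :=
  ψ u - ψ v - fderiv ℝ ψ v (u - v)

/-- A base regularizer on a simplex: continuous and strongly convex on the simplex, and
differentiable in its relative interior and wherever a linear perturbation of it attains its
minimum over the simplex, so that `∇ψ` exists at all points produced by mirror descent. The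
negative entropy and the squared Euclidean norm are examples. -/
structure IsBaseRegularizer {κ : Type} [Fintype κ] (ψ : (κ → ℝ) → ℝ) : Prop where
  continuousOn : ContinuousOn ψ (stdSimplex ℝ κ)
  strongConvexOn : ∃ m : ℝ, 0 < m ∧ StrongConvexOn (stdSimplex ℝ κ) m ψ
  differentiableAt_interior :
    ∀ p ∈ stdSimplex ℝ κ, (∀ i, 0 < p i) → DifferentiableAt ℝ ψ p
  differentiableAt_argmin : ∀ g : κ → ℝ, ∀ p ∈ stdSimplex ℝ κ,
    IsMinOn (fun p' => ∑ i, p' i * g i + ψ p') (stdSimplex ℝ κ) p → DifferentiableAt ℝ ψ p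

namespace Treeplex

variable {n : ℕ} {T : Treeplex n}

/-- The dilated regularizer `ψ^Z(z) = ∑_h α_h z_{σ(h)} ψ_h(z_h / z_{σ(h)})`
(a term with `z_{σ(h)} = 0` is `0`). -/
def dilated (ψ : ∀ h : T.Infoset, (T.Omega h → ℝ) → ℝ) (α : T.Infoset → ℝ)
    (z : Fin n → ℝ) : ℝ :=
  ∑ h, α h * T.reach z h * ψ h (fun i => z i.1 / T.reach z h)

/-- The gradient `∇ψ^Z` at a strategy, written through its local strategies `q`:
`(∇ψ^Z)_i = α_{h(i)} ∂_i ψ_{h(i)}(q_{h(i)}) + ∑_{h : σ(h) = i} α_h (ψ_h(q_h) - ⟨∇ψ_h(q_h), q_h⟩)`.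
Where all `z_{σ(h)}` are positive this is the gradient of `dilated` (`hasFDerivAt_dilated`). -/
def dilatedGrad (ψ : ∀ h : T.Infoset, (T.Omega h → ℝ) → ℝ) (α : T.Infoset → ℝ)
    (s : T.Strategy) (i : Fin n) : ℝ :=
  α (T.infoset i) * fderiv ℝ (ψ (T.infoset i)) (s.locAt (T.infoset i)) (Pi.single ⟨i, rfl⟩ 1) +
    ∑ h with T.parent h = some i,
      α h * (ψ h (s.locAt h) - fderiv ℝ (ψ h) (s.locAt h) (s.locAt h))

theorem hasFDerivAt_dilated (ψ : ∀ h : T.Infoset, (T.Omega h → ℝ) → ℝ) (α : T.Infoset → ℝ)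
    (s : T.Strategy) (hpos : ∀ h, 0 < T.reach s.seq h)
    (hd : ∀ h, DifferentiableAt ℝ (ψ h) (s.locAt h)) :
    HasFDerivAt (dilated ψ α)
      (∑ i, dilatedGrad ψ α s i • ContinuousLinearMap.proj (R := ℝ) (φ := fun _ : Fin n => ℝ) i)
      s.seq := by
  let R : T.Infoset → ((Fin n → ℝ) →L[ℝ] ℝ) := fun h =>
    (T.parent h).elim 0 (fun i => ContinuousLinearMap.proj (R := ℝ) (φ := fun _ : Fin n => ℝ) i)
  have hR : ∀ h, HasFDerivAt (fun z => T.reach z h) (R h) s.seq := by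
    intro h
    unfold reach
    simp only [R]
    cases T.parent h with
    | none => exact hasFDerivAt_const _ _
    | some i => exact (ContinuousLinearMap.proj (R := ℝ) (φ := fun _ : Fin n => ℝ) i).hasFDerivAt
  have hq : ∀ h, (fun i : T.Omega h => s.seq i.1 / T.reach s.seq h) = s.locAt h := by
    intro h
    funext i
    obtain ⟨i, rfl⟩ := i
    have h1 := s.seq_eq i
    have h2 := (hpos (T.infoset i)).ne'
    simp only [Strategy.locAt]
    rw [div_eq_iff h2]
    exact h1
  let P : ∀ h : T.Infoset, ((Fin n → ℝ) →L[ℝ] (T.Omega h → ℝ)) := fun h =>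
    ContinuousLinearMap.pi fun i => (T.reach s.seq h)⁻¹ •
      (ContinuousLinearMap.proj (R := ℝ) (φ := fun _ : Fin n => ℝ) i.1 - s.loc i.1 • R h)
  have hP : ∀ h, HasFDerivAt (fun z : Fin n → ℝ => fun i : T.Omega h => z i.1 / T.reach z h)
      (P h) s.seq := by
    intro h
    rw [hasFDerivAt_pi]
    intro i
    have h2 := (hpos h).ne'
    have h0 : HasFDerivAt (fun z => (T.reach z h)⁻¹) (-(T.reach s.seq h ^ 2)⁻¹ • R h) s.seq :=
      (hasDerivAt_inv h2).comp_hasFDerivAt s.seq (hR h)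
    have h1 := ((ContinuousLinearMap.proj (R := ℝ) (φ := fun _ : Fin n => ℝ)
      i.1).hasFDerivAt (x := s.seq)).fun_mul h0
    simp only [ContinuousLinearMap.proj_apply, ← div_eq_mul_inv] at h1
    refine h1.congr_fderiv ?_
    ext v
    have h3 := congrFun (hq h) i
    simp only [Strategy.locAt] at h3
    change s.seq i.1 * (-(T.reach s.seq h ^ 2)⁻¹ * R h v) + (T.reach s.seq h)⁻¹ * v i.1 =
      (T.reach s.seq h)⁻¹ * (v i.1 - s.loc i.1 * R h v)
    rw [← h3]
    field_simp
    ring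
  have hterm : ∀ h, HasFDerivAt
      (fun z => α h * T.reach z h * ψ h (fun i => z i.1 / T.reach z h))
      ((α h * T.reach s.seq h) • ((fderiv ℝ (ψ h) (s.locAt h)).comp (P h)) +
        ψ h (s.locAt h) • (α h • R h)) s.seq := by
    intro h
    have h1 : HasFDerivAt (ψ h) (fderiv ℝ (ψ h) (s.locAt h))
        ((fun z : Fin n → ℝ => fun i : T.Omega h => z i.1 / T.reach z h) s.seq) := by
      simp only [hq h]
      exact (hd h).hasFDerivAt
    have h2 := h1.comp s.seq (hP h)
    have h3 := ((hR h).const_mul (α h)).fun_mul h2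
    simpa only [Function.comp, hq h] using h3
  have hsum := HasFDerivAt.fun_sum (u := Finset.univ) fun h _ => hterm h
  refine hsum.congr_fderiv ?_
  ext v
  have hRv : ∀ h, R h v = ∑ i, if T.parent h = some i then v i else 0 := by
    intro h
    simp only [R]
    cases T.parent h with
    | none => simp
    | some i => simp
  have hfib : ∀ h, fderiv ℝ (ψ h) (s.locAt h) (fun i => v i.1) =
      ∑ i : T.Omega h, v i.1 * fderiv ℝ (ψ h) (s.locAt h) (Pi.single i 1) := by
    intro h
    conv_lhs => rw [pi_eq_sum_univ' (fun i : T.Omega h => v i.1)]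
    simp [map_sum]
  have hPv : ∀ h, P h v = (T.reach s.seq h)⁻¹ •
      ((fun i : T.Omega h => v i.1) - R h v • s.locAt h) := by
    intro h
    funext i
    simp [P, Strategy.locAt, mul_comm]
  have hleft : ∀ h, ((α h * T.reach s.seq h) • ((fderiv ℝ (ψ h) (s.locAt h)).comp (P h)) +
        ψ h (s.locAt h) • (α h • R h)) v =
      (∑ i : T.Omega h, α h * (v i.1 * fderiv ℝ (ψ h) (s.locAt h) (Pi.single i 1))) +
        ∑ i, if T.parent h = some i then
          v i * (α h * (ψ h (s.locAt h) - fderiv ℝ (ψ h) (s.locAt h) (s.locAt h))) else 0 := by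
    intro h
    have h2 := (hpos h).ne'
    have h3 : (∑ i, if T.parent h = some i then
        v i * (α h * (ψ h (s.locAt h) - fderiv ℝ (ψ h) (s.locAt h) (s.locAt h))) else 0) =
        R h v * (α h * (ψ h (s.locAt h) - fderiv ℝ (ψ h) (s.locAt h) (s.locAt h))) := by
      rw [hRv, Finset.sum_mul]
      refine Finset.sum_congr rfl fun i _ => ?_
      split_ifs <;> simp
    rw [h3, ← Finset.mul_sum, ← hfib]
    simp only [_root_.add_apply, _root_.smul_apply,
      ContinuousLinearMap.comp_apply, hPv, map_smul, map_sub, smul_eq_mul]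
    field_simp
    ring
  rw [_root_.sum_apply, Finset.sum_congr rfl fun h _ => hleft h,
    Finset.sum_add_distrib, _root_.sum_apply]
  have hA : (∑ h, ∑ i : T.Omega h,
      α h * (v i.1 * fderiv ℝ (ψ h) (s.locAt h) (Pi.single i 1))) =
      ∑ i, α (T.infoset i) * (v i * fderiv ℝ (ψ (T.infoset i)) (s.locAt (T.infoset i))
        (Pi.single ⟨i, rfl⟩ 1)) := by
    rw [← Fintype.sum_sigma']
    refine Fintype.sum_equiv (Equiv.sigmaFiberEquiv T.infoset) _ _ ?_
    rintro ⟨h, i, rfl⟩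
    rfl
  rw [hA, Finset.sum_comm, ← Finset.sum_add_distrib]
  refine Finset.sum_congr rfl fun i _ => ?_
  simp only [_root_.smul_apply, ContinuousLinearMap.proj_apply, smul_eq_mul,
    dilatedGrad, Finset.sum_filter]
  rw [add_mul, Finset.sum_mul]
  congr 1
  · ring
  · refine Finset.sum_congr rfl fun h _ => ?_
    split_ifs <;> ring

/-- The Bregman divergence `D_{ψ^Z}(z, s)` of the dilated regularizer. -/
def dilatedBregman (ψ : ∀ h : T.Infoset, (T.Omega h → ℝ) → ℝ) (α : T.Infoset → ℝ)
    (z : Fin n → ℝ) (s : T.Strategy) : ℝ :=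
  dilated ψ α z - dilated ψ α s.seq - ∑ i, dilatedGrad ψ α s i * (z i - s.seq i)

/-- `ψ^Z` is 1-strongly convex with respect to the 2-norm:
`D_{ψ^Z}(z, s) ≥ ‖z - s‖² / 2` wherever the divergence is defined. -/
def DilatedStronglyConvex (ψ : ∀ h : T.Infoset, (T.Omega h → ℝ) → ℝ)
    (α : T.Infoset → ℝ) : Prop :=
  ∀ z ∈ T.carrier, ∀ s : T.Strategy,
    (∀ h, DifferentiableAt ℝ (ψ h) (s.locAt h)) →
      1 / 2 * ‖WithLp.toLp 2 (z - s.seq)‖ ^ 2 ≤ dilatedBregman ψ α z s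

/-- One mirror step `s = argmin_{z ∈ Z} ⟨z, g⟩ + (1/η) D_{ψ^Z}(z, c)`.

`seq_min` is this minimization. `loc_min` says that the local strategies of `s` are optimal
below every information set, also below those that `s` itself reaches with probability `0`
(elsewhere it follows from `seq_min`): with `V h` the optimal value of the part of the problem
at and below `h`, conditional on reaching `h`, the local strategy at `h` minimizes the local
objective over the simplex. -/
structure IsMirrorStep (ψ : ∀ h : T.Infoset, (T.Omega h → ℝ) → ℝ) (α : T.Infoset → ℝ)
    (η : ℝ) (g : Fin n → ℝ) (c s : T.Strategy) : Prop where
  seq_min : IsMinOn (fun z => ∑ i, z i * g i + 1 / η * dilatedBregman ψ α z c) T.carrier s.seq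
  loc_min : ∃ V : T.Infoset → ℝ, ∀ h,
    let Q : (T.Omega h → ℝ) → ℝ := fun p =>
      ∑ i, p i * (g i.1 + ∑ h' with T.parent h' = some i.1, V h') +
        1 / η * (α h * bregman (ψ h) p (c.locAt h))
    IsMinOn Q (stdSimplex ℝ (T.Omega h)) (s.locAt h) ∧ V h = Q (s.locAt h)

end Treeplex

section Game

variable {M N : ℕ}

/-- The min-player's part `x` of `z = (x, y)`. -/
def minPart (z : Fin (M + N) → ℝ) : Fin M → ℝ := fun i => z (Fin.castAdd N i)

/-- The max-player's part `y` of `z = (x, y)`. -/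
def maxPart (z : Fin (M + N) → ℝ) : Fin N → ℝ := fun j => z (Fin.natAdd M j)

/-- `F(z) = (A y, -Aᵀ x)`. -/
def gameGrad (A : Matrix (Fin M) (Fin N) ℝ) (z : Fin (M + N) → ℝ) : Fin (M + N) → ℝ :=
  Fin.append (A.mulVec (maxPart z)) (-(A.transpose.mulVec (minPart z)))

/-- The duality gap `max_{w ∈ Z} F(z)ᵀ (z - w)`. -/
def dualityGap (X : Treeplex M) (Y : Treeplex N) (A : Matrix (Fin M) (Fin N) ℝ)
    (z : Fin (M + N) → ℝ) : ℝ :=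
  sSup ((fun w => gameGrad A z ⬝ᵥ (z - w)) '' (X.prod Y).carrier)

/-- The set of Nash equilibria (saddle points) of `min_{x ∈ X} max_{y ∈ Y} xᵀ A y`. -/
def nashSet (X : Treeplex M) (Y : Treeplex N) (A : Matrix (Fin M) (Fin N) ℝ) :
    Set (Fin (M + N) → ℝ) :=
  {z | z ∈ (X.prod Y).carrier ∧
    (∀ x ∈ X.carrier, minPart z ⬝ᵥ A.mulVec (maxPart z) ≤ x ⬝ᵥ A.mulVec (maxPart z)) ∧
    (∀ y ∈ Y.carrier, minPart z ⬝ᵥ A.mulVec y ≤ minPart z ⬝ᵥ A.mulVec (maxPart z))}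

/-- `p` is a Euclidean projection of `u` onto `K`. -/
def IsEuclideanProj {d : ℕ} (K : Set (Fin d → ℝ)) (u p : Fin d → ℝ) : Prop :=
  p ∈ K ∧ ∀ w ∈ K, ‖WithLp.toLp 2 (u - p)‖ ≤ ‖WithLp.toLp 2 (u - w)‖

/-- One episode of regularized dilated optimistic mirror descent: `len` iterations with
stepsize `η` and weight `τ`, started at `z_0 = ẑ_1 = ` the uniform strategy; iteration `r + 1`
computes `z_{r+1}` and `ẑ_{r+2}`. -/
structure IsEpisode {X : Treeplex M} {Y : Treeplex N}
    (ψ : ∀ h : (X.prod Y).Infoset, ((X.prod Y).Omega h → ℝ) → ℝ)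
    (α : (X.prod Y).Infoset → ℝ) (A : Matrix (Fin M) (Fin N) ℝ) (η τ : ℝ) (len : ℕ)
    (z zhat : ℕ → (X.prod Y).Strategy) : Prop where
  init : (z 0).IsUniform
  init_hat : (zhat 1).IsUniform
  step : ∀ r < len, Treeplex.IsMirrorStep ψ α η
    (fun i => gameGrad A (z r).seq i + τ * Treeplex.dilatedGrad ψ α (zhat (r + 1)) i)
    (zhat (r + 1)) (z (r + 1))
  step_hat : ∀ r < len, Treeplex.IsMirrorStep ψ α η
    (fun i => gameGrad A (z (r + 1)).seq i + τ * Treeplex.dilatedGrad ψ α (zhat (r + 1)) i)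
    (zhat (r + 1)) (zhat (r + 2))

/-- The regularization weight of episode `k`: halved after each episode. -/
def weight (τ₀ : ℝ) (k : ℕ) : ℝ := τ₀ / 2 ^ k

/-- The number `(2 / (η τ)) log (1 / τ)` of iterations after which an episode with weight `τ`
has contracted by the factor `τ²`. -/
def burnIn (η τ : ℝ) : ℝ := 2 / (η * τ) * Real.log (1 / τ)

/-- Episode lengths of order `Θ̃(1/τ_k)`: long enough for the contraction, and at most
`(c / τ_k) (1 + log (1 / τ_k))^p`. -/
def IsSchedule (η τ₀ c : ℝ) (p : ℕ) (len : ℕ → ℕ) : Prop :=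
  ∀ k, 1 ≤ len k ∧ burnIn η (weight τ₀ k) ≤ len k ∧
    (len k : ℝ) ≤ c / weight τ₀ k * (1 + Real.log (1 / weight τ₀ k)) ^ p

end Game

end

/-!
Fix an episode with weight `τ` and let `u` be its regularized equilibrium: the point of the treeplex
with `τ ψ(u) ≤ F(u)ᵀ z + τ ψ(z)` for all `z`. It exists by Sion's minimax theorem, because `F` is
skew and the dilated regularizer `ψ` is convex and continuous
(`exists_regularized_equilibrium`, `Treeplex.convexOn_dilated`, `Treeplex.continuousOn_dilated`).

Local optimality of a mirror step at all information sets, also those it does not reach, adds up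
along the tree to the usual first-order condition for `dilatedGrad`
(`Treeplex.IsMirrorStep.variational`), hence to the three-point inequality of mirror descent.
Applied to both half-steps of an iteration, with the step size absorbing the prediction error, it
contracts the potential `D(u, ẑ) + 7/16 ‖ẑ - z‖²` by the factor `1 - ητ`
(`mirror_iteration_contracts`). The initial divergence is bounded independently of the payoffs and
of `τ`, so after the burn-in `D(u, ẑ) = O(τ²)`, `‖ẑ - u‖ = O(τ)`, and the duality gap, which is
`O(τ)` at `u` and Lipschitz, is `O(τ)` at `ẑ` (`exists_gap_le_of_burnIn_le`).

Since the weights are halved, the first `k` episodes and part of the next one last at most a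
constant times `(1 + log (1 / τ_k))^p / τ_k` iterations, while the burn-in of the preceding episode
forces at least order `1 / τ_k` of them; so `τ_k = O((1 + log t)^p / t)`
(`IsSchedule.weight_le`).

The distance to the Nash equilibria is bounded by the gap through Hoffman's error bound
(`exists_error_bound`): on a polytope the gap is a maximum of finitely many linear functions, and
the bound needs to be checked only at the finitely many extreme points of its epigraph. No
uniqueness of the equilibrium enters.
-/

noncomputable section

/-! ### Polyhedra: finitely many extreme points and an error bound -/

/-- An extreme point of a polyhedron is determined by the set of constraints active at it. -/
theorem finite_extremePoints_polyhedron {E J : Type*} [AddCommGroup E] [Module ℝ E] [Finite J]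
    (f : J → E →ₗ[ℝ] ℝ) (b : J → ℝ) :
    (Set.extremePoints ℝ {x | ∀ j, f j x ≤ b j}).Finite := by
  refine Set.Finite.of_finite_image (f := fun x => {j | f j x = b j}) (Set.toFinite _) ?_
  intro x hx y hy hxy
  rw [mem_extremePoints] at hx
  have hxQ : ∀ j, f j x ≤ b j := hx.1
  have hact : ∀ j, f j x = b j → f j y = b j := fun j hj => by
    have : j ∈ {j | f j x = b j} := hj
    simp only at hxy
    rw [hxy] at this
    exact this
  have hev : ∀ᶠ ε : ℝ in nhds 0, ∀ j, f j x + ε * (f j y - f j x) ≤ b j := by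
    rw [Filter.eventually_all]
    intro j
    rcases (hxQ j).eq_or_lt with hj | hj
    · filter_upwards with ε
      rw [hact j hj, hj]
      simp
    · have hc : Filter.Tendsto (fun ε : ℝ => f j x + ε * (f j y - f j x)) (nhds 0)
          (nhds (f j x + 0 * (f j y - f j x))) :=
        Continuous.tendsto (by fun_prop) 0
      rw [zero_mul, add_zero] at hc
      filter_upwards [hc.eventually (gt_mem_nhds hj)] with ε hε using hε.le
  obtain ⟨r, hr, hball⟩ := Metric.eventually_nhds_iff.1 hev
  have h1 : x + (r / 2) • (y - x) ∈ {x | ∀ j, f j x ≤ b j} := fun j => by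
    have := @hball (r / 2) (by rw [Real.dist_eq, sub_zero, abs_of_pos (by linarith)]; linarith) j
    simpa using this
  have h2 : x + (-(r / 2)) • (y - x) ∈ {x | ∀ j, f j x ≤ b j} := fun j => by
    have := @hball (-(r / 2))
      (by rw [Real.dist_eq, sub_zero, abs_neg, abs_of_pos (by linarith)]; linarith) j
    simpa using this
  have h3 : x ∈ openSegment ℝ (x + (r / 2) • (y - x)) (x + (-(r / 2)) • (y - x)) :=
    ⟨1 / 2, 1 / 2, by norm_num, by norm_num, by norm_num, by module⟩
  have h4 := (hx.2 _ h1 _ h2 h3).1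
  have h5 : (r / 2) • (y - x) = 0 := by simpa using h4
  rcases smul_eq_zero.1 h5 with h | h
  · linarith
  · exact (sub_eq_zero.1 h).symm

/-- Hoffman's error bound on a polytope: the distance to the solutions of `g j z ≤ 0` is at most
a constant times the violation. The set of pairs (point, admissible violation `≤ 1`) is a polytope
over the simplex of convex weights; the bound holds at its finitely many extreme points and is
preserved by convex combinations. -/
theorem exists_error_bound {E J : Type*} [NormedAddCommGroup E] [NormedSpace ℝ E] [Finite J]
    {V : Set E} (hV : V.Finite) (g : J → E →ₗ[ℝ] ℝ)
    (hne : ∃ z ∈ convexHull ℝ V, ∀ j, g j z ≤ 0) :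
    ∃ C : ℝ, 0 ≤ C ∧ ∀ z ∈ convexHull ℝ V, ∀ ε : ℝ, 0 ≤ ε → (∀ j, g j z ≤ ε) →
      ∃ z' ∈ convexHull ℝ V, (∀ j, g j z' ≤ 0) ∧ ‖z - z'‖ ≤ C * ε := by
  obtain ⟨z₀, hz₀, hgz₀⟩ := hne
  let _ := hV.fintype
  let L : (V → ℝ) →ₗ[ℝ] E := ∑ x : V, (LinearMap.proj (R := ℝ) x).smulRight x.1
  have hL : convexHull ℝ V = L '' stdSimplex ℝ V := hV.convexHull_eq_image
  let f : (V ⊕ Bool) ⊕ (J ⊕ Bool) → (V → ℝ) × ℝ →ₗ[ℝ] ℝ :=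
    Sum.elim
      (Sum.elim (fun v => -(LinearMap.proj v ∘ₗ LinearMap.fst ℝ _ _))
        (fun c => (if c then (1 : ℝ) else -1) •
          ((∑ v : V, LinearMap.proj v) ∘ₗ LinearMap.fst ℝ _ _)))
      (Sum.elim (fun j => g j ∘ₗ L ∘ₗ LinearMap.fst ℝ _ _ - LinearMap.snd ℝ _ _)
        (fun c => (if c then (1 : ℝ) else -1) • LinearMap.snd ℝ _ _))
  let b : (V ⊕ Bool) ⊕ (J ⊕ Bool) → ℝ :=
    Sum.elim (Sum.elim 0 (fun c => if c then 1 else -1))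
      (Sum.elim 0 (fun c => if c then 1 else 0))
  let Q : Set ((V → ℝ) × ℝ) := {x | ∀ j, f j x ≤ b j}
  have hQ : ∀ x, x ∈ Q ↔ x.1 ∈ stdSimplex ℝ V ∧ (∀ j, g j (L x.1) ≤ x.2) ∧ 0 ≤ x.2 ∧ x.2 ≤ 1 := by
    intro x
    simp only [Q, Set.mem_ofPred_eq, Sum.forall, Bool.forall_bool, f, b, stdSimplex]
    simp
    grind
  have hfc : ∀ j, Continuous (f j) := fun j => LinearMap.continuous_of_finiteDimensional _
  have hclosed : IsClosed Q := by
    simp only [Q, Set.ofPred_forall]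
    exact isClosed_iInter fun j => isClosed_le (hfc j) continuous_const
  have hcomp : IsCompact Q := by
    refine IsCompact.of_isClosed_subset
      ((isCompact_stdSimplex ℝ V).prod (isCompact_Icc (a := (0 : ℝ)) (b := 1))) hclosed ?_
    intro x hx
    have := (hQ x).1 hx
    exact ⟨this.1, this.2.2⟩
  have hconv : Convex ℝ Q := by
    simp only [Q, Set.ofPred_forall]
    exact convex_iInter fun j => convex_halfSpace_le (f j).isLinear _
  have hfin : (Set.extremePoints ℝ Q).Finite := finite_extremePoints_polyhedron f b
  have hKM : convexHull ℝ (Set.extremePoints ℝ Q) = Q := by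
    rw [← (hfin.isClosed_convexHull ℝ).closure_eq]
    exact closure_convexHull_extremePoints hcomp hconv
  obtain ⟨C₁, hC₁⟩ := (hfin.image fun x => ‖L x.1 - z₀‖ / x.2).bddAbove
  obtain ⟨C₂, hC₂⟩ := (hV.isCompact_convexHull ℝ).isBounded.exists_norm_le
  have hC₁' : ∀ x ∈ Set.extremePoints ℝ Q, ‖L x.1 - z₀‖ / x.2 ≤ max C₁ 0 := fun x hx =>
    (hC₁ ⟨x, hx, rfl⟩).trans (le_max_left _ _)
  -- the pairs for which the error bound holds form a convex set
  let G : Set ((V → ℝ) × ℝ) := {x | ∃ z' ∈ convexHull ℝ V, (∀ j, g j z' ≤ 0) ∧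
    ‖L x.1 - z'‖ ≤ max C₁ 0 * x.2}
  have hG : Convex ℝ G := by
    rintro x ⟨x', hx', hgx, hxx⟩ y ⟨y', hy', hgy, hyy⟩ a c ha hc hac
    refine ⟨a • x' + c • y', convex_convexHull ℝ V hx' hy' ha hc hac, fun j => ?_, ?_⟩
    · rw [map_add, map_smul, map_smul, smul_eq_mul, smul_eq_mul]
      nlinarith [hgx j, hgy j]
    · have : L (a • x + c • y).1 - (a • x' + c • y') = a • (L x.1 - x') + c • (L y.1 - y') := by
        simp only [Prod.fst_add, Prod.smul_fst, map_add, map_smul]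
        module
      rw [this]
      calc _ ≤ ‖a • (L x.1 - x')‖ + ‖c • (L y.1 - y')‖ := norm_add_le _ _
        _ = a * ‖L x.1 - x'‖ + c * ‖L y.1 - y'‖ := by
          rw [norm_smul, norm_smul, Real.norm_of_nonneg ha, Real.norm_of_nonneg hc]
        _ ≤ a * (max C₁ 0 * x.2) + c * (max C₁ 0 * y.2) := by gcongr
        _ = max C₁ 0 * (a • x + c • y).2 := by
          simp only [Prod.snd_add, Prod.smul_snd, smul_eq_mul]
          ring
  have hQG : Q ⊆ G := by
    rw [← hKM]
    refine convexHull_min (fun x hx => ?_) hG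
    obtain ⟨hx1, hxg, hx0, -⟩ := (hQ x).1 (extremePoints_subset hx)
    rcases hx0.eq_or_lt with h0 | h0
    · refine ⟨L x.1, hL ▸ ⟨x.1, hx1, rfl⟩, fun j => (hxg j).trans h0.symm.le, ?_⟩
      simp [← h0]
    · exact ⟨z₀, hz₀, hgz₀, (div_le_iff₀ h0).1 (hC₁' x hx)⟩
  refine ⟨max (max C₁ 0) (2 * C₂), (le_max_right _ _).trans (le_max_left _ _),
    fun z hz ε hε hgz => ?_⟩
  rcases le_total ε 1 with h1 | h1
  · rw [hL] at hz
    obtain ⟨w, hw, rfl⟩ := hz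
    obtain ⟨z', hz', hgz', hd⟩ := hQG ((hQ (w, ε)).2 ⟨hw, hgz, hε, h1⟩)
    exact ⟨z', hz', hgz', hd.trans (mul_le_mul_of_nonneg_right (le_max_left _ _) hε)⟩
  · refine ⟨z₀, hz₀, hgz₀, ?_⟩
    have hz0 : 0 ≤ C₂ := (norm_nonneg _).trans (hC₂ z₀ hz₀)
    calc ‖z - z₀‖ ≤ ‖z‖ + ‖z₀‖ := norm_sub_le _ _
      _ ≤ 2 * C₂ * 1 := by linarith [hC₂ z hz, hC₂ z₀ hz₀]
      _ ≤ _ := mul_le_mul (le_max_right _ _) h1 zero_le_one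
        ((by positivity : 0 ≤ max C₁ 0).trans (le_max_left _ _))

/-! ### Regularized equilibria -/

/-- A regularized variational inequality for a skew bilinear form has a solution: it is the first
half of a saddle point of `(x, y) ↦ φ x - φ y - B x y`, whose value is nonpositive because the
form vanishes on the diagonal. -/
theorem exists_regularized_equilibrium {n : ℕ} {K : Set (Fin n → ℝ)} (hne : K.Nonempty)
    (hK : IsCompact K) (B : (Fin n → ℝ) →ₗ[ℝ] (Fin n → ℝ) →ₗ[ℝ] ℝ) (hB : ∀ x, B x x = 0)
    {φ : (Fin n → ℝ) → ℝ} (hφ : ConvexOn ℝ K φ) (hφc : ContinuousOn φ K) :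
    ∃ u ∈ K, ∀ z ∈ K, φ u ≤ B u z + φ z := by
  have hc1 : ∀ y, Continuous fun x => B x y := fun y =>
    LinearMap.continuous_of_finiteDimensional (B.flip y)
  have hc2 : ∀ x, Continuous (B x) := fun x => LinearMap.continuous_of_finiteDimensional (B x)
  obtain ⟨a, ha, b, hb, hab⟩ := Sion.exists_isSaddlePointOn (X := K) (Y := K)
    (f := fun x y => φ x - φ y - B x y) hne hφ.1 hK
    (fun y hy => ((hφc.sub continuousOn_const).sub (hc1 y).continuousOn).lowerSemicontinuousOn)
    (fun y hy => ((hφ.add_const (-φ y)).sub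
      (LinearMap.concaveOn (B.flip y) hφ.1)).quasiconvexOn)
    hφ.1 hne hK
    (fun x hx => ((continuousOn_const.sub hφc).sub (hc2 x).continuousOn).upperSemicontinuousOn)
    (fun x hx => ((hφ.neg.add_const (φ x)).sub
      (LinearMap.convexOn (B x) hφ.1)).congr (fun y _ => by simp; ring) |>.quasiconcaveOn)
  refine ⟨a, ha, fun z hz => ?_⟩
  have := hab b hb z hz
  simp only [hB, sub_self] at this
  linarith

/-! ### The geometry of treeplexes -/

namespace Treeplex

theorem pos_dim : {n : ℕ} → Treeplex n → 0 < n
  | _, simplex _ => Nat.succ_pos _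
  | _, prod S _ => Nat.add_pos_left S.pos_dim _
  | _, branch S _ _ => Nat.add_pos_left S.pos_dim _

theorem mem_Icc_of_mem_carrier : {n : ℕ} → (T : Treeplex n) → ∀ z ∈ T.carrier,
    ∀ i, z i ∈ Set.Icc (0 : ℝ) 1
  | _, simplex _ => fun _ hz i => mem_Icc_of_mem_stdSimplex hz i
  | _, prod S T => by
    rintro _ ⟨u, hu, v, hv, rfl⟩ i
    refine Fin.addCases (fun i => ?_) (fun i => ?_) i
    · simpa using S.mem_Icc_of_mem_carrier u hu i
    · simpa using T.mem_Icc_of_mem_carrier v hv i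
  | _, branch S j T => by
    rintro _ ⟨u, hu, v, hv, rfl⟩ i
    refine Fin.addCases (fun i => ?_) (fun i => ?_) i
    · simpa using S.mem_Icc_of_mem_carrier u hu i
    · have h1 := S.mem_Icc_of_mem_carrier u hu j
      have h2 := T.mem_Icc_of_mem_carrier v hv i
      simp only [Fin.append_right, Pi.smul_apply, smul_eq_mul]
      exact ⟨mul_nonneg h1.1 h2.1, mul_le_one₀ h1.2 h2.1 h2.2⟩

section Branching

variable {m n : ℕ} {S : Treeplex m} {T : Treeplex n}

/-- An information set of the first factor of a product or branching, among those of the whole;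
the named injections fix the type `Infoset`, which is a sum type only after unfolding. -/
def prodInl (h : S.Infoset) : (prod S T).Infoset := (Sum.inl h : S.Infoset ⊕ T.Infoset)

/-- An information set of the second factor of a product. -/
def prodInr (h : T.Infoset) : (prod S T).Infoset := (Sum.inr h : S.Infoset ⊕ T.Infoset)

/-- An information set of the first part of a branching. -/
def branchInl (j : Fin m) (h : S.Infoset) : (branch S j T).Infoset :=
  (Sum.inl h : S.Infoset ⊕ T.Infoset)

/-- An information set of the second part of a branching. -/
def branchInr (j : Fin m) (h : T.Infoset) : (branch S j T).Infoset :=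
  (Sum.inr h : S.Infoset ⊕ T.Infoset)

theorem infoset_prod_castAdd (i : Fin m) :
    (prod S T).infoset (Fin.castAdd n i) = prodInl (S.infoset i) :=
  Fin.append_left _ _ _

theorem infoset_prod_natAdd (i : Fin n) :
    (prod S T).infoset (Fin.natAdd m i) = prodInr (T.infoset i) :=
  Fin.append_right _ _ _

theorem sum_infoset_prod_inl (w : Fin (m + n) → ℝ) (h : S.Infoset) :
    (∑ i, if (prod S T).infoset i = prodInl h then w i else 0) =
      ∑ i, if S.infoset i = h then w (Fin.castAdd n i) else 0 := by
  have h1 : ∀ i : Fin m, (prod S T).infoset (Fin.castAdd n i) =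
      prodInl h ↔ S.infoset i = h := fun i => by
    rw [infoset_prod_castAdd]; exact Sum.inl.inj_iff
  have h2 : ∀ i : Fin n, (prod S T).infoset (Fin.natAdd m i) ≠
      prodInl h := fun i => by
    rw [infoset_prod_natAdd]; exact Sum.inr_ne_inl
  rw [Fin.sum_univ_add, Finset.sum_eq_zero (s := Finset.univ (α := Fin n)), add_zero]
  · exact Finset.sum_congr rfl fun i _ => by simp only [h1]
  · exact fun i _ => if_neg (h2 i)

theorem sum_infoset_prod_inr (w : Fin (m + n) → ℝ) (h : T.Infoset) :
    (∑ i, if (prod S T).infoset i = prodInr h then w i else 0) =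
      ∑ i, if T.infoset i = h then w (Fin.natAdd m i) else 0 := by
  have h1 : ∀ i : Fin n, (prod S T).infoset (Fin.natAdd m i) =
      prodInr h ↔ T.infoset i = h := fun i => by
    rw [infoset_prod_natAdd]; exact Sum.inr.inj_iff
  have h2 : ∀ i : Fin m, (prod S T).infoset (Fin.castAdd n i) ≠
      prodInr h := fun i => by
    rw [infoset_prod_castAdd]; exact Sum.inl_ne_inr
  rw [Fin.sum_univ_add, Finset.sum_eq_zero (s := Finset.univ (α := Fin m)), zero_add]
  · exact Finset.sum_congr rfl fun i _ => by simp only [h1]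
  · exact fun i _ => if_neg (h2 i)

theorem reach_prod_inl (u : Fin m → ℝ) (v : Fin n → ℝ) (h : S.Infoset) :
    (prod S T).reach (Fin.append u v) (prodInl h) = S.reach u h := by
  change (((prod S T).parent (prodInl h)).elim 1 _ : ℝ) = (S.parent h).elim 1 u
  change ((Option.map (Fin.castAdd n) (S.parent h)).elim 1 _ : ℝ) = _
  cases S.parent h <;> simp

theorem infoset_branch_castAdd (j : Fin m) (i : Fin m) :
    (branch S j T).infoset (Fin.castAdd n i) = branchInl j (S.infoset i) :=
  Fin.append_left _ _ _

theorem infoset_branch_natAdd (j : Fin m) (i : Fin n) :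
    (branch S j T).infoset (Fin.natAdd m i) = branchInr j (T.infoset i) :=
  Fin.append_right _ _ _

theorem sum_infoset_branch_inl (j : Fin m) (w : Fin (m + n) → ℝ) (h : S.Infoset) :
    (∑ i, if (branch S j T).infoset i = branchInl j h then w i else 0) =
      ∑ i, if S.infoset i = h then w (Fin.castAdd n i) else 0 := by
  have h1 : ∀ i : Fin m, (branch S j T).infoset (Fin.castAdd n i) =
      branchInl j h ↔ S.infoset i = h := fun i => by
    rw [infoset_branch_castAdd]; exact Sum.inl.inj_iff
  have h2 : ∀ i : Fin n, (branch S j T).infoset (Fin.natAdd m i) ≠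
      branchInl j h := fun i => by
    rw [infoset_branch_natAdd]; exact Sum.inr_ne_inl
  rw [Fin.sum_univ_add, Finset.sum_eq_zero (s := Finset.univ (α := Fin n)), add_zero]
  · exact Finset.sum_congr rfl fun i _ => by simp only [h1]
  · exact fun i _ => if_neg (h2 i)

theorem sum_infoset_branch_inr (j : Fin m) (w : Fin (m + n) → ℝ) (h : T.Infoset) :
    (∑ i, if (branch S j T).infoset i = branchInr j h then w i else 0) =
      ∑ i, if T.infoset i = h then w (Fin.natAdd m i) else 0 := by
  have h1 : ∀ i : Fin n, (branch S j T).infoset (Fin.natAdd m i) =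
      branchInr j h ↔ T.infoset i = h := fun i => by
    rw [infoset_branch_natAdd]; exact Sum.inr.inj_iff
  have h2 : ∀ i : Fin m, (branch S j T).infoset (Fin.castAdd n i) ≠
      branchInr j h := fun i => by
    rw [infoset_branch_castAdd]; exact Sum.inl_ne_inr
  rw [Fin.sum_univ_add, Finset.sum_eq_zero (s := Finset.univ (α := Fin m)), zero_add]
  · exact Finset.sum_congr rfl fun i _ => by simp only [h1]
  · exact fun i _ => if_neg (h2 i)

theorem reach_branch_inl (j : Fin m) (u : Fin m → ℝ) (v : Fin n → ℝ) (h : S.Infoset) :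
    (branch S j T).reach (Fin.append u v) (branchInl j h) = S.reach u h := by
  change (((branch S j T).parent (branchInl j h)).elim 1 _ : ℝ) = (S.parent h).elim 1 u
  change ((Option.map (Fin.castAdd n) (S.parent h)).elim 1 _ : ℝ) = _
  cases S.parent h <;> simp

theorem reach_prod_inr (u : Fin m → ℝ) (v : Fin n → ℝ) (h : T.Infoset) :
    (prod S T).reach (Fin.append u v) (prodInr h) = T.reach v h := by
  change ((Option.map (Fin.natAdd m) (T.parent h)).elim 1 _ : ℝ) = (T.parent h).elim 1 v
  cases T.parent h <;> simp

theorem reach_branch_inr (j : Fin m) (u : Fin m → ℝ) (v : Fin n → ℝ) (h : T.Infoset) :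
    (branch S j T).reach (Fin.append u (u j • v)) (branchInr j h) =
      u j * T.reach v h := by
  change ((some ((T.parent h).elim (Fin.castAdd n j) (Fin.natAdd m))).elim 1 _ : ℝ) =
    u j * (T.parent h).elim 1 v
  cases T.parent h <;> simp

end Branching

/-- The flow constraint: the entries of an information set sum to the parent's entry. -/
theorem sum_infoset_eq_reach : {n : ℕ} → (T : Treeplex n) → ∀ z ∈ T.carrier, ∀ h,
    (∑ i, if T.infoset i = h then z i else 0) = T.reach z h
  | _, simplex m => by
    intro z hz h
    have h1 : ∀ i, (simplex m).infoset i = h := fun _ => rfl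
    simp only [h1, if_true]
    exact hz.2
  | _, prod S T => by
    rintro _ ⟨u, hu, v, hv, rfl⟩ (h | h)
    · refine (sum_infoset_prod_inl _ h).trans (Eq.trans ?_ (reach_prod_inl u v h).symm)
      simpa using S.sum_infoset_eq_reach u hu h
    · refine (sum_infoset_prod_inr _ h).trans (Eq.trans ?_ (reach_prod_inr u v h).symm)
      simpa using T.sum_infoset_eq_reach v hv h
  | _, branch S j T => by
    rintro _ ⟨u, hu, v, hv, rfl⟩ (h | h)
    · refine (sum_infoset_branch_inl j _ h).trans (Eq.trans ?_ (reach_branch_inl j u _ h).symm)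
      simpa using S.sum_infoset_eq_reach u hu h
    · refine (sum_infoset_branch_inr j _ h).trans (Eq.trans ?_ (reach_branch_inr j u v h).symm)
      rw [← T.sum_infoset_eq_reach v hv h, Finset.mul_sum]
      simp

/-- Positive local strategies determine a sequence form with positive entries. -/
theorem exists_mem_carrier_of_loc : {n : ℕ} → (T : Treeplex n) → ∀ q : Fin n → ℝ,
    (∀ i, 0 < q i) → (∀ h, (∑ i, if T.infoset i = h then q i else 0) = 1) →
    ∃ z ∈ T.carrier, (∀ i, z i = q i * T.reach z (T.infoset i)) ∧ ∀ i, 0 < z i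
  | _, simplex m => by
    intro q hq hs
    refine ⟨q, ⟨fun i => (hq i).le, ?_⟩, fun i => ?_, hq⟩
    · have h1 : ∀ i, (simplex m).infoset i = () := fun _ => rfl
      have h2 := hs (() : Unit)
      rw [← h2]
      exact Finset.sum_congr rfl fun i _ => (if_pos (h1 i)).symm
    · simp [reach, parent]
  | _, prod (m := m) (n := n) S T => by
    intro q hq hs
    obtain ⟨u, hu, hue, hup⟩ := S.exists_mem_carrier_of_loc (fun i => q (Fin.castAdd n i))
      (fun i => hq _)
      (fun h => (sum_infoset_prod_inl (T := T) q h).symm.trans (hs _))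
    obtain ⟨v, hv, hve, hvp⟩ := T.exists_mem_carrier_of_loc (fun i => q (Fin.natAdd m i))
      (fun i => hq _)
      (fun h => (sum_infoset_prod_inr (S := S) q h).symm.trans (hs _))
    refine ⟨_, ⟨u, hu, v, hv, rfl⟩, fun i => ?_, fun i => ?_⟩
    · refine Fin.addCases (fun i => ?_) (fun i => ?_) i
      · rw [Fin.append_left, infoset_prod_castAdd, reach_prod_inl]
        exact hue i
      · rw [Fin.append_right, infoset_prod_natAdd, reach_prod_inr]
        exact hve i
    · refine Fin.addCases (fun i => ?_) (fun i => ?_) i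
      · simpa using hup i
      · simpa using hvp i
  | _, branch (m := m) (n := n) S j T => by
    intro q hq hs
    obtain ⟨u, hu, hue, hup⟩ := S.exists_mem_carrier_of_loc (fun i => q (Fin.castAdd n i))
      (fun i => hq _)
      (fun h => (sum_infoset_branch_inl (T := T) j q h).symm.trans (hs _))
    obtain ⟨v, hv, hve, hvp⟩ := T.exists_mem_carrier_of_loc (fun i => q (Fin.natAdd m i))
      (fun i => hq _)
      (fun h => (sum_infoset_branch_inr (S := S) j q h).symm.trans (hs _))
    refine ⟨_, ⟨u, hu, v, hv, rfl⟩, fun i => ?_, fun i => ?_⟩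
    · refine Fin.addCases (fun i => ?_) (fun i => ?_) i
      · rw [Fin.append_left, infoset_branch_castAdd, reach_branch_inl]
        exact hue i
      · rw [Fin.append_right, infoset_branch_natAdd, reach_branch_inr]
        rw [Pi.smul_apply, smul_eq_mul, hve i]
        ring
    · refine Fin.addCases (fun i => ?_) (fun i => ?_) i
      · simpa using hup i
      · simpa using mul_pos (hup j) (hvp i)

/-- A treeplex is a polytope. -/
theorem exists_carrier_eq_convexHull : {n : ℕ} → (T : Treeplex n) →
    ∃ V : Set (Fin n → ℝ), V.Finite ∧ V.Nonempty ∧ T.carrier = convexHull ℝ V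
  | _, simplex m => ⟨_, Set.finite_range _, Set.range_nonempty _,
      (convexHull_rangle_single_eq_stdSimplex ℝ (Fin (m + 1))).symm⟩
  | _, prod (m := m) (n := n) S T => by
    obtain ⟨V, hVf, hVn, hV⟩ := S.exists_carrier_eq_convexHull
    obtain ⟨W, hWf, hWn, hW⟩ := T.exists_carrier_eq_convexHull
    let L : (Fin m → ℝ) × (Fin n → ℝ) →ₗ[ℝ] (Fin (m + n) → ℝ) :=
      { toFun := fun x => Fin.append x.1 x.2
        map_add' := fun x y => by
          ext i; refine Fin.addCases (fun i => ?_) (fun i => ?_) i <;> simp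
        map_smul' := fun c x => by
          ext i; refine Fin.addCases (fun i => ?_) (fun i => ?_) i <;> simp }
    refine ⟨L '' (V ×ˢ W), (hVf.prod hWf).image _, (hVn.prod hWn).image _, ?_⟩
    rw [← LinearMap.image_convexHull, convexHull_prod, ← hV, ← hW]
    ext z
    constructor
    · rintro ⟨u, hu, v, hv, rfl⟩
      exact ⟨(u, v), ⟨hu, hv⟩, rfl⟩
    · rintro ⟨⟨u, v⟩, ⟨hu, hv⟩, rfl⟩
      exact ⟨u, hu, v, hv, rfl⟩
  | _, branch (m := m) (n := n) S j T => by
    obtain ⟨V, hVf, hVn, hV⟩ := S.exists_carrier_eq_convexHull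
    obtain ⟨W, hWf, hWn, hW⟩ := T.exists_carrier_eq_convexHull
    have hconv : Convex ℝ (branch S j T).carrier := by
      rintro _ ⟨u, hu, v, hv, rfl⟩ _ ⟨u', hu', v', hv', rfl⟩ a b ha hb hab
      have hSc : Convex ℝ S.carrier := hV ▸ convex_convexHull ℝ V
      have hTc : Convex ℝ T.carrier := hW ▸ convex_convexHull ℝ W
      have h1 := mul_nonneg ha (S.mem_Icc_of_mem_carrier u hu j).1
      have h2 := mul_nonneg hb (S.mem_Icc_of_mem_carrier u' hu' j).1
      have hex : ∃ w ∈ T.carrier, (a * u j + b * u' j) • w = (a * u j) • v + (b * u' j) • v' := by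
        rcases (add_nonneg h1 h2).eq_or_lt with h0 | h0
        · refine ⟨v, hv, ?_⟩
          have h3 : a * u j = 0 := by linarith
          have h4 : b * u' j = 0 := by linarith
          simp [h3, h4]
        · refine ⟨(a * u j / (a * u j + b * u' j)) • v + (b * u' j / (a * u j + b * u' j)) • v',
            hTc hv hv' (by positivity) (by positivity) (by field_simp), ?_⟩
          rw [smul_add, smul_smul, smul_smul, mul_div_cancel₀ _ h0.ne', mul_div_cancel₀ _ h0.ne']
      obtain ⟨w, hw, hwe⟩ := hex
      refine ⟨a • u + b • u', hSc hu hu' ha hb hab, w, hw, ?_⟩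
      have : (a • u + b • u') j • w = a • u j • v + b • u' j • v' := by
        simpa [smul_smul] using hwe
      rw [this]
      ext i
      refine Fin.addCases (fun i => ?_) (fun i => ?_) i <;> simp
    let f : (Fin m → ℝ) → (Fin n → ℝ) → (Fin (m + n) → ℝ) := fun u v => Fin.append u (u j • v)
    refine ⟨Set.image2 f V W, hVf.image2 _ hWf, hVn.image2 hWn, Set.Subset.antisymm ?_ ?_⟩
    · rintro _ ⟨u, hu, v, hv, rfl⟩
      -- the map `f` is linear in its first and affine in its second argument
      have hlin1 : ∀ v, IsLinearMap ℝ (fun u => f u v) := fun v =>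
        ⟨fun x y => by
          ext i; refine Fin.addCases (fun i => ?_) (fun i => ?_) i <;> simp [f, add_mul],
         fun c x => by
          ext i; refine Fin.addCases (fun i => ?_) (fun i => ?_) i <;> simp [f, mul_assoc]⟩
      have hK := convex_convexHull ℝ (Set.image2 f V W)
      have h1 : ∀ u ∈ V, T.carrier ⊆ {v | f u v ∈ convexHull ℝ (Set.image2 f V W)} := by
        intro u hu
        rw [hW]
        refine convexHull_min (fun v hv => subset_convexHull ℝ _ ⟨u, hu, v, hv, rfl⟩) ?_
        intro x hx y hy a b ha hb hab
        have : f u (a • x + b • y) = a • f u x + b • f u y := by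
          ext i
          refine Fin.addCases (fun i => ?_) (fun i => ?_) i
          · simp [f, ← add_mul, hab]
          · simp [f]; ring
        simp only [Set.mem_ofPred_eq, this]
        exact hK hx hy ha hb hab
      have h2 : S.carrier ⊆ {u | f u v ∈ convexHull ℝ (Set.image2 f V W)} := by
        rw [hV]
        refine convexHull_min (fun u hu => h1 u hu hv) ?_
        intro x hx y hy a b ha hb hab
        simp only [Set.mem_ofPred_eq, (hlin1 v).map_add, (hlin1 v).map_smul]
        exact hK hx hy ha hb hab
      exact h2 hu
    · refine convexHull_min ?_ hconv
      rintro _ ⟨u, hu, v, hv, rfl⟩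
      exact ⟨u, hV ▸ subset_convexHull ℝ V hu, v, hW ▸ subset_convexHull ℝ W hv, rfl⟩

variable {n : ℕ} (T : Treeplex n)

theorem convex_carrier : Convex ℝ T.carrier := by
  obtain ⟨V, -, -, h⟩ := T.exists_carrier_eq_convexHull
  exact h ▸ convex_convexHull ℝ V

theorem isCompact_carrier : IsCompact T.carrier := by
  obtain ⟨V, hV, -, h⟩ := T.exists_carrier_eq_convexHull
  exact h ▸ hV.isCompact_convexHull ℝ

theorem carrier_nonempty : T.carrier.Nonempty := by
  obtain ⟨V, -, hV, h⟩ := T.exists_carrier_eq_convexHull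
  exact h ▸ hV.convexHull

variable {T} {z : Fin n → ℝ}

theorem reach_mem_Icc (hz : z ∈ T.carrier) (h : T.Infoset) : T.reach z h ∈ Set.Icc (0 : ℝ) 1 := by
  unfold reach
  cases T.parent h with
  | none => simp
  | some i => exact T.mem_Icc_of_mem_carrier z hz i

theorem sum_Omega (w : Fin n → ℝ) (h : T.Infoset) :
    ∑ i : T.Omega h, w i.1 = ∑ i, if T.infoset i = h then w i else 0 := by
  rw [← Finset.sum_filter, ← Finset.sum_subtype_eq_sum_filter]
  simp [Finset.subtype_univ]

theorem sum_Omega_eq_reach (hz : z ∈ T.carrier) (h : T.Infoset) :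
    ∑ i : T.Omega h, z i.1 = T.reach z h := by
  rw [sum_Omega, T.sum_infoset_eq_reach z hz]

theorem le_reach (hz : z ∈ T.carrier) {h : T.Infoset} (i : T.Omega h) : z i.1 ≤ T.reach z h := by
  rw [← sum_Omega_eq_reach hz h]
  exact Finset.single_le_sum (f := fun i : T.Omega h => z i.1)
    (fun j _ => (T.mem_Icc_of_mem_carrier z hz j.1).1) (Finset.mem_univ i)

theorem div_reach_mem (hz : z ∈ T.carrier) {h : T.Infoset} (hr : 0 < T.reach z h) :
    (fun i : T.Omega h => z i.1 / T.reach z h) ∈ stdSimplex ℝ (T.Omega h) := by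
  refine ⟨fun i => div_nonneg (T.mem_Icc_of_mem_carrier z hz i.1).1 hr.le, ?_⟩
  rw [← Finset.sum_div, sum_Omega_eq_reach hz, div_self hr.ne']

theorem eq_zero_of_reach (hz : z ∈ T.carrier) {h : T.Infoset} (hr : T.reach z h = 0)
    (i : T.Omega h) : z i.1 = 0 :=
  le_antisymm ((le_reach hz i).trans hr.le) (T.mem_Icc_of_mem_carrier z hz i.1).1

/-- The entries at `h` of a point of the treeplex are its reach times a point of the simplex. -/
theorem exists_eq_reach_smul (hz : z ∈ T.carrier) (h : T.Infoset)
    (hn : (stdSimplex ℝ (T.Omega h)).Nonempty) :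
    ∃ p ∈ stdSimplex ℝ (T.Omega h), (fun i : T.Omega h => z i.1) = T.reach z h • p ∧
      (0 < T.reach z h → p = fun i : T.Omega h => z i.1 / T.reach z h) := by
  rcases (reach_mem_Icc hz h).1.eq_or_lt with h0 | h0
  · obtain ⟨p, hp⟩ := hn
    refine ⟨p, hp, ?_, fun h1 => absurd h0 h1.ne⟩
    funext i
    simp [← h0, eq_zero_of_reach hz h0.symm i]
  · refine ⟨_, div_reach_mem hz h0, ?_, fun _ => rfl⟩
    funext i
    simp [mul_div_cancel₀ _ h0.ne']

end Treeplex

/-! ### The dilated regularizer -/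

/-- First-order optimality of a mirror step on a simplex, together with the differentiability of
the regularizer at the minimizer. -/
theorem IsBaseRegularizer.first_order {κ : Type} [Fintype κ] {ψ : (κ → ℝ) → ℝ}
    (hψ : IsBaseRegularizer ψ) {a η : ℝ} (ha : 0 ≤ a) (hη : 0 < η) {G c s : κ → ℝ}
    (hs : s ∈ stdSimplex ℝ κ)
    (hmin : IsMinOn (fun p => ∑ i, p i * G i + 1 / η * (a * bregman ψ p c)) (stdSimplex ℝ κ) s) :
    (0 < a → DifferentiableAt ℝ ψ s) ∧ ∀ p ∈ stdSimplex ℝ κ,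
      0 ≤ η * ∑ i, G i * (p i - s i) + a * (fderiv ℝ ψ s (p - s) - fderiv ℝ ψ c (p - s)) := by
  classical
  rcases ha.eq_or_lt with h0 | h0
  · subst h0
    refine ⟨fun h => absurd h (lt_irrefl _), fun p hp => ?_⟩
    have h1 := isMinOn_iff.1 hmin p hp
    have h2 : ∑ i, G i * (p i - s i) = ∑ i, p i * G i - ∑ i, s i * G i := by
      rw [← Finset.sum_sub_distrib]
      exact Finset.sum_congr rfl fun i _ => by ring
    simp only [zero_mul, mul_zero, add_zero] at h1 ⊢
    rw [h2]
    exact mul_nonneg hη.le (sub_nonneg.2 h1)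
  · -- up to a constant, the objective is `a / η` times a linear perturbation of `ψ`
    let G' : κ → ℝ := fun i => η / a * G i - fderiv ℝ ψ c (Pi.single i 1)
    have hlin : ∀ v : κ → ℝ, ∑ i, v i * G' i = η / a * ∑ i, v i * G i - fderiv ℝ ψ c v := by
      intro v
      have : fderiv ℝ ψ c v = ∑ i, v i * fderiv ℝ ψ c (Pi.single i 1) := by
        conv_lhs => rw [pi_eq_sum_univ' v]
        simp [map_sum]
      rw [this, Finset.mul_sum, ← Finset.sum_sub_distrib]
      exact Finset.sum_congr rfl fun i _ => by simp only [G']; ring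
    have hmin' : IsMinOn (fun p => ∑ i, p i * G' i + ψ p) (stdSimplex ℝ κ) s := by
      rw [isMinOn_iff] at hmin ⊢
      intro p hp
      have h1 := mul_le_mul_of_nonneg_left (hmin p hp) (div_pos hη h0).le
      have h2 : ∀ p : κ → ℝ, ∑ i, p i * G' i + ψ p =
          η / a * (∑ i, p i * G i + 1 / η * (a * bregman ψ p c)) +
            (ψ c - fderiv ℝ ψ c c) := by
        intro p
        rw [hlin, bregman, map_sub]
        field_simp
        ring
      rw [h2, h2]
      linarith
    have hd : DifferentiableAt ℝ ψ s := hψ.differentiableAt_argmin G' s hs hmin'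
    refine ⟨fun _ => hd, fun p hp => ?_⟩
    let ℓ : (κ → ℝ) →L[ℝ] ℝ :=
      ∑ i, G' i • ContinuousLinearMap.proj (R := ℝ) (φ := fun _ : κ => ℝ) i
    have hℓ : ∀ v, ℓ v = ∑ i, v i * G' i := fun v => by simp [ℓ, mul_comm]
    have hder : HasFDerivAt (fun p => ∑ i, p i * G' i + ψ p) (ℓ + fderiv ℝ ψ s) s := by
      have := ℓ.hasFDerivAt (x := s)
      simp only [funext hℓ] at this
      exact this.add hd.hasFDerivAt
    have h1 := hmin'.localize.hasFDerivWithinAt_nonneg hder.hasFDerivWithinAt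
      (sub_mem_posTangentConeAt_of_segment_subset ((convex_stdSimplex ℝ κ).segment_subset hs hp))
    rw [_root_.add_apply, hℓ, hlin] at h1
    have h2 : ∑ i, (p - s) i * G i = ∑ i, G i * (p i - s i) :=
      Finset.sum_congr rfl fun i _ => by simp only [Pi.sub_apply]; ring
    rw [h2] at h1
    have h3 := mul_nonneg h0.le h1
    have h4 : a * (η / a * ∑ i, G i * (p i - s i) - fderiv ℝ ψ c (p - s) + fderiv ℝ ψ s (p - s)) =
        η * ∑ i, G i * (p i - s i) + a * (fderiv ℝ ψ s (p - s) - fderiv ℝ ψ c (p - s)) := by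
      field_simp
      ring
    rwa [h4] at h3

namespace Treeplex

variable {n : ℕ} {T : Treeplex n}

theorem sum_infoset_fiber (f : ∀ h : T.Infoset, T.Omega h → ℝ) :
    ∑ i, f (T.infoset i) ⟨i, rfl⟩ = ∑ h, ∑ i, f h i := by
  rw [← Fintype.sum_sigma']
  refine (Fintype.sum_equiv (Equiv.sigmaFiberEquiv T.infoset) _ _ ?_).symm
  rintro ⟨h, i, rfl⟩
  rfl

theorem sum_mul_sum_parent (v : Fin n → ℝ) (c : T.Infoset → ℝ) :
    ∑ i, v i * ∑ h with T.parent h = some i, c h = ∑ h, (T.parent h).elim 0 v * c h := by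
  simp only [Finset.sum_filter, Finset.mul_sum]
  rw [Finset.sum_comm]
  refine Finset.sum_congr rfl fun h _ => ?_
  cases T.parent h <;> simp

theorem parent_elim_sub (z w : Fin n → ℝ) (h : T.Infoset) :
    (T.parent h).elim 0 (z - w) = T.reach z h - T.reach w h := by
  unfold reach
  cases T.parent h <;> simp

theorem Strategy.seq_eq_smul (s : T.Strategy) (h : T.Infoset) :
    (fun i : T.Omega h => s.seq i.1) = T.reach s.seq h • s.locAt h := by
  funext ⟨i, hi⟩
  subst hi
  simp only [Pi.smul_apply, smul_eq_mul, Strategy.locAt]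
  rw [s.seq_eq i, mul_comm]

variable {ψ : ∀ h : T.Infoset, (T.Omega h → ℝ) → ℝ} {α : T.Infoset → ℝ}

/-- The pairing with the gradient, regrouped by information sets. -/
theorem sum_dilatedGrad_mul (s : T.Strategy) (v : Fin n → ℝ) :
    ∑ i, dilatedGrad ψ α s i * v i =
      ∑ h, α h * (fderiv ℝ (ψ h) (s.locAt h) (fun i => v i.1) +
        (T.parent h).elim 0 v *
          (ψ h (s.locAt h) - fderiv ℝ (ψ h) (s.locAt h) (s.locAt h))) := by
  have h1 : ∀ i, dilatedGrad ψ α s i * v i =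
      α (T.infoset i) * (v i * fderiv ℝ (ψ (T.infoset i)) (s.locAt (T.infoset i))
        (Pi.single ⟨i, rfl⟩ 1)) + v i * ∑ h with T.parent h = some i,
          α h * (ψ h (s.locAt h) - fderiv ℝ (ψ h) (s.locAt h) (s.locAt h)) := fun i => by
    rw [dilatedGrad]
    ring
  simp only [h1, Finset.sum_add_distrib, mul_add]
  congr 1
  · rw [sum_infoset_fiber (fun h i => α h * (v i.1 * fderiv ℝ (ψ h) (s.locAt h) (Pi.single i 1)))]
    refine Finset.sum_congr rfl fun h _ => ?_
    rw [← Finset.mul_sum]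
    congr 1
    conv_rhs => rw [pi_eq_sum_univ' (fun i : T.Omega h => v i.1)]
    simp [map_sum]
  · rw [sum_mul_sum_parent]
    exact Finset.sum_congr rfl fun h _ => by ring

/-- The dilated divergence is the sum over the information sets of the local divergences, weighted
by the reach of the first argument. -/
theorem dilatedBregman_eq (z : Fin n → ℝ) (s : T.Strategy) :
    dilatedBregman ψ α z s = ∑ h, α h * (T.reach z h * ψ h (fun i => z i.1 / T.reach z h) -
      T.reach z h * ψ h (s.locAt h) -
        fderiv ℝ (ψ h) (s.locAt h) ((fun i => z i.1) - T.reach z h • s.locAt h)) := by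
  have h1 := sum_dilatedGrad_mul (ψ := ψ) (α := α) s (z - s.seq)
  simp only [Pi.sub_apply] at h1
  rw [dilatedBregman, h1, dilated, dilated, ← Finset.sum_sub_distrib, ← Finset.sum_sub_distrib]
  refine Finset.sum_congr rfl fun h _ => ?_
  have h2 : (fun i : T.Omega h => z i.1 - s.seq i.1) =
      (fun i => z i.1) - T.reach s.seq h • s.locAt h := by
    rw [← s.seq_eq_smul h]
    rfl
  have h3 : T.reach s.seq h * ψ h (fun i => s.seq i.1 / T.reach s.seq h) =
      T.reach s.seq h * ψ h (s.locAt h) := by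
    rcases eq_or_ne (T.reach s.seq h) 0 with h0 | h0
    · rw [h0, zero_mul, zero_mul]
    · congr 2
      funext i
      have := congrFun (s.seq_eq_smul h) i
      simp only [Pi.smul_apply, smul_eq_mul] at this
      rw [this, mul_div_cancel_left₀ _ h0]
  rw [mul_assoc (α h) (T.reach s.seq h), h3, h2, parent_elim_sub]
  simp only [map_sub, map_smul, smul_eq_mul]
  ring

/-- The divergence vanishes at strategies that agree with `s` locally wherever they are reached and
the weight is nonzero. -/
theorem dilatedBregman_eq_zero {z : Fin n → ℝ} {s : T.Strategy}
    (hz : ∀ h, α h ≠ 0 → (fun i : T.Omega h => z i.1) = T.reach z h • s.locAt h) :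
    dilatedBregman ψ α z s = 0 := by
  rw [dilatedBregman_eq]
  refine Finset.sum_eq_zero fun h _ => ?_
  rcases eq_or_ne (α h) 0 with hα | hα
  · rw [hα, zero_mul]
  have h1 := hz h hα
  rw [h1, sub_self, map_zero, sub_zero]
  rcases eq_or_ne (T.reach z h) 0 with h0 | h0
  · simp [h0]
  · have : (fun i : T.Omega h => z i.1 / T.reach z h) = s.locAt h := by
      funext i
      have := congrFun h1 i
      simp only [Pi.smul_apply, smul_eq_mul] at this
      rw [this, mul_div_cancel_left₀ _ h0]
    rw [this, sub_self, mul_zero]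

theorem differentiableAt_of_pos (hψ : ∀ h, IsBaseRegularizer (ψ h)) (s : T.Strategy)
    (hpos : ∀ i, 0 < s.loc i) (h : T.Infoset) : DifferentiableAt ℝ (ψ h) (s.locAt h) :=
  (hψ h).differentiableAt_interior _ (s.loc_mem h) fun _ => hpos _

/-- Where the weight vanishes, strong convexity leaves no room for more than one action: moving
mass between two actions would change the strategy but not the divergence. -/
theorem subsingleton_Omega_of_weight_eq_zero (hψ : ∀ h, IsBaseRegularizer (ψ h))
    (hsc : DilatedStronglyConvex ψ α) (s₀ : T.Strategy) {h : T.Infoset} (h0 : α h = 0) :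
    Subsingleton (T.Omega h) := by
  by_contra hns
  rw [not_subsingleton_iff_nontrivial] at hns
  obtain ⟨⟨i, hi⟩, ⟨j, hj⟩, hij⟩ := hns
  have hij' : i ≠ j := fun h => hij (Subtype.ext h)
  let q : Fin n → ℝ := fun i => 1 / (Fintype.card (T.Omega (T.infoset i)) : ℝ)
  have hcard : ∀ i, 0 < (Fintype.card (T.Omega (T.infoset i)) : ℝ) := fun i =>
    Nat.cast_pos.2 (Fintype.card_pos_iff.2 ⟨⟨i, rfl⟩⟩)
  have hq : ∀ i, 0 < q i := fun i => one_div_pos.2 (hcard i)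
  -- a sequence form with given positive local strategies
  have key : ∀ q' : Fin n → ℝ, (∀ i, 0 < q' i) → (∀ h, ∑ i : T.Omega h, q' i.1 = 1) →
      ∃ s : T.Strategy, s.loc = q' ∧ ∀ i, 0 < s.seq i := by
    intro q' hq' hs
    obtain ⟨z, hz, hze, hzp⟩ := T.exists_mem_carrier_of_loc q' hq'
      (fun h => by rw [← sum_Omega, hs])
    exact ⟨⟨z, q', hz, fun h => ⟨fun i => (hq' i.1).le, hs h⟩, hze⟩, rfl, hzp⟩
  have hqs : ∀ h' : T.Infoset, ∑ i : T.Omega h', q i.1 = 1 := by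
    intro h'
    obtain ⟨⟨k, rfl⟩⟩ : Nonempty (T.Omega h') := by
      by_contra hemp
      rw [not_nonempty_iff] at hemp
      simpa using (s₀.loc_mem h').2
    have : ∀ i : T.Omega (T.infoset k), q i.1 = 1 / (Fintype.card (T.Omega (T.infoset k)) : ℝ) :=
      fun i => by simp only [q, i.2]
    simp only [this, Finset.sum_const, Finset.card_univ, nsmul_eq_mul]
    exact mul_one_div_cancel (hcard k).ne'
  let q' : Fin n → ℝ := fun k => if k = i then q i / 2 else if k = j then q j + q i / 2 else q k
  have hq' : ∀ k, 0 < q' k := by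
    intro k
    have := hq i
    have := hq j
    have := hq k
    simp only [q']
    split_ifs <;> linarith
  have hqq : ∀ h', h' ≠ h → ∀ k : T.Omega h', q' k.1 = q k.1 := by
    rintro h' hh ⟨k, rfl⟩
    simp only [q']
    rw [if_neg (by rintro rfl; exact hh hi), if_neg (by rintro rfl; exact hh hj)]
  have hqs' : ∀ h', ∑ k : T.Omega h', q' k.1 = 1 := by
    intro h'
    rcases eq_or_ne h' h with rfl | hh
    · rw [← hqs h']
      have h1 : ∀ k : T.Omega h', q' k.1 =
          q k.1 + ((if k = ⟨j, hj⟩ then q i / 2 else 0) - if k = ⟨i, hi⟩ then q i / 2 else 0) := by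
        rintro ⟨k, hk⟩
        simp only [q', Subtype.mk.injEq]
        by_cases h1 : k = i
        · subst h1
          rw [if_pos rfl, if_pos rfl, if_neg hij']
          ring
        · by_cases h2 : k = j
          · subst h2
            rw [if_neg h1, if_pos rfl, if_pos rfl, if_neg h1]
            ring
          · rw [if_neg h1, if_neg h2, if_neg h1, if_neg h2]
            ring
      simp only [h1, Finset.sum_add_distrib, Finset.sum_sub_distrib]
      simp
    · simp only [hqq h' hh, hqs h']
  obtain ⟨s, hs, hsp⟩ := key q hq hqs
  obtain ⟨s', hs', -⟩ := key q' hq' hqs'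
  have h1 := hsc s'.seq s'.seq_mem s
    (differentiableAt_of_pos hψ s (fun i => hs ▸ hq i))
  rw [dilatedBregman_eq_zero] at h1
  · have h2 : ‖WithLp.toLp 2 (s'.seq - s.seq)‖ = 0 := by
      nlinarith [norm_nonneg (WithLp.toLp 2 (s'.seq - s.seq))]
    rw [norm_eq_zero, WithLp.toLp_eq_zero, sub_eq_zero] at h2
    have h3 := s'.seq_eq i
    rw [h2, s.seq_eq i, hs, hs'] at h3
    have h4 : 0 < T.reach s.seq (T.infoset i) := by
      unfold reach
      cases T.parent (T.infoset i) with
      | none => simp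
      | some k => exact hsp k
    have h5 := mul_right_cancel₀ h4.ne' h3
    simp only [q', if_true] at h5
    linarith [hq i]
  · intro h' hα
    rw [s'.seq_eq_smul]
    congr 1
    funext k
    simp only [Strategy.locAt, hs, hs']
    exact hqq h' (fun hh => hα (hh ▸ h0)) k

/-! ### Mirror steps -/

/-- The base regularizers are differentiable at the local strategies of every mirror step. -/
theorem IsMirrorStep.differentiableAt (hψ : ∀ h, IsBaseRegularizer (ψ h)) (hα : ∀ h, 0 ≤ α h)
    (hsc : DilatedStronglyConvex ψ α) {η : ℝ} (hη : 0 < η) {g : Fin n → ℝ} {c s : T.Strategy}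
    (hstep : IsMirrorStep ψ α η g c s) (h : T.Infoset) :
    DifferentiableAt ℝ (ψ h) (s.locAt h) := by
  rcases (hα h).eq_or_lt with h0 | h0
  · have := subsingleton_Omega_of_weight_eq_zero hψ hsc s h0.symm
    refine (hψ h).differentiableAt_interior _ (s.loc_mem h) fun i => ?_
    have h1 := (s.loc_mem h).2
    rw [Fintype.sum_subsingleton _ i] at h1
    exact (zero_lt_one.trans_eq h1.symm)
  · obtain ⟨V, hV⟩ := hstep.loc_min
    exact ((hψ h).first_order (hα h) hη (s.loc_mem h) (hV h).1).1 h0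

/-- First-order optimality of a mirror step. The local optimality conditions, weighted by the
reach probabilities of `u`, add up: the values `V` passed up the tree telescope. -/
theorem IsMirrorStep.variational (hψ : ∀ h, IsBaseRegularizer (ψ h)) (hα : ∀ h, 0 ≤ α h)
    {η : ℝ} (hη : 0 < η) {g : Fin n → ℝ} {c s : T.Strategy}
    (hstep : IsMirrorStep ψ α η g c s) {u : Fin n → ℝ} (hu : u ∈ T.carrier) :
    0 ≤ ∑ i, (η * g i + dilatedGrad ψ α s i - dilatedGrad ψ α c i) * (u i - s.seq i) := by
  obtain ⟨V, hV⟩ := hstep.loc_min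
  let G : ∀ h, T.Omega h → ℝ := fun h i => g i.1 + ∑ h' with T.parent h' = some i.1, V h'
  let Δ : ∀ h, (T.Omega h → ℝ) →L[ℝ] ℝ := fun h =>
    fderiv ℝ (ψ h) (s.locAt h) - fderiv ℝ (ψ h) (c.locAt h)
  let ρ : T.Infoset → ℝ := fun h => (T.parent h).elim 0 (u - s.seq)
  have hVeq : ∀ h, η * V h = η * ∑ i, G h i * s.locAt h i +
      α h * bregman (ψ h) (s.locAt h) (c.locAt h) := by
    intro h
    have : ∑ i, G h i * s.locAt h i = ∑ i, s.locAt h i * G h i :=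
      Finset.sum_congr rfl fun i _ => mul_comm _ _
    rw [this, (hV h).2]
    simp only [G]
    field_simp
  have hg : ∑ i, g i * (u - s.seq) i = ∑ h, (∑ i, G h i * (u - s.seq) i.1 - ρ h * V h) := by
    rw [Finset.sum_sub_distrib, ← sum_mul_sum_parent, ← sum_infoset_fiber
      (fun h i => G h i * (u - s.seq) i.1), ← Finset.sum_sub_distrib]
    exact Finset.sum_congr rfl fun i _ => by simp only [G]; ring
  have hmain : ∑ i, (η * g i + dilatedGrad ψ α s i - dilatedGrad ψ α c i) * (u i - s.seq i) =
      ∑ h, (η * ∑ i, G h i * ((u - s.seq) i.1 - ρ h * s.locAt h i) +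
        α h * Δ h (fun i => (u - s.seq) i.1 - ρ h * s.locAt h i)) := by
    have h1 : ∑ i, (η * g i + dilatedGrad ψ α s i - dilatedGrad ψ α c i) * (u i - s.seq i) =
        η * ∑ i, g i * (u - s.seq) i + ∑ i, dilatedGrad ψ α s i * (u - s.seq) i -
          ∑ i, dilatedGrad ψ α c i * (u - s.seq) i := by
      rw [Finset.mul_sum, ← Finset.sum_add_distrib, ← Finset.sum_sub_distrib]
      exact Finset.sum_congr rfl fun i _ => by simp only [Pi.sub_apply]; ring
    rw [h1, hg, sum_dilatedGrad_mul, sum_dilatedGrad_mul, Finset.mul_sum,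
      ← Finset.sum_add_distrib, ← Finset.sum_sub_distrib]
    refine Finset.sum_congr rfl fun h _ => ?_
    have h2 : (fun i : T.Omega h => (u - s.seq) i.1 - ρ h * s.locAt h i) =
        (fun i : T.Omega h => (u - s.seq) i.1) - ρ h • s.locAt h := rfl
    have h3 : ∑ i, G h i * ((u - s.seq) i.1 - ρ h * s.locAt h i) =
        ∑ i, G h i * (u - s.seq) i.1 - ρ h * ∑ i, G h i * s.locAt h i := by
      rw [Finset.mul_sum, ← Finset.sum_sub_distrib]
      exact Finset.sum_congr rfl fun i _ => by ring
    have h4 := hVeq h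
    rw [bregman, map_sub] at h4
    rw [h2, h3, map_sub, map_smul, smul_eq_mul]
    simp only [Δ, _root_.sub_apply]
    change η * (_ - ρ h * V h) + α h * (_ + ρ h * _) - α h * (_ + ρ h * _) = _
    linear_combination -ρ h * h4
  rw [hmain]
  refine Finset.sum_nonneg fun h _ => ?_
  obtain ⟨p, hp, hup, -⟩ := exists_eq_reach_smul hu h ⟨_, s.loc_mem h⟩
  have h1 : (fun i : T.Omega h => (u - s.seq) i.1 - ρ h * s.locAt h i) =
      T.reach u h • (p - s.locAt h) := by
    funext i
    have h2 := congrFun hup i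
    have h3 := congrFun (s.seq_eq_smul h) i
    simp only [Pi.smul_apply, smul_eq_mul] at h2 h3
    simp only [ρ, parent_elim_sub, Pi.sub_apply, Pi.smul_apply, smul_eq_mul, h2, h3]
    ring
  have h2 : ∑ i, G h i * ((u - s.seq) i.1 - ρ h * s.locAt h i) =
      T.reach u h * ∑ i, G h i * (p i - s.locAt h i) := by
    rw [Finset.mul_sum]
    refine Finset.sum_congr rfl fun i _ => ?_
    have := congrFun h1 i
    simp only [Pi.smul_apply, smul_eq_mul, Pi.sub_apply] at this
    simp only [Pi.sub_apply, this]
    ring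
  have h3 : 0 ≤ η * ∑ i, G h i * (p i - s.locAt h i) + α h *
      (fderiv ℝ (ψ h) (s.locAt h) (p - s.locAt h) - fderiv ℝ (ψ h) (c.locAt h) (p - s.locAt h)) :=
    ((hψ h).first_order (hα h) hη (s.loc_mem h) (hV h).1).2 p hp
  have h4 := mul_nonneg (reach_mem_Icc hu h).1 h3
  rw [h2, h1, map_smul, smul_eq_mul]
  simp only [Δ, _root_.sub_apply]
  refine h4.trans_eq ?_
  ring

/-- The three-point inequality of mirror descent. -/
theorem IsMirrorStep.three_point (hψ : ∀ h, IsBaseRegularizer (ψ h)) (hα : ∀ h, 0 ≤ α h)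
    {η : ℝ} (hη : 0 < η) {g : Fin n → ℝ} {c s : T.Strategy}
    (hstep : IsMirrorStep ψ α η g c s) {u : Fin n → ℝ} (hu : u ∈ T.carrier) :
    η * ∑ i, g i * (s.seq i - u i) ≤
      dilatedBregman ψ α u c - dilatedBregman ψ α u s - dilatedBregman ψ α s.seq c := by
  have h1 := hstep.variational hψ hα hη hu
  have h2 : ∑ i, (η * g i + dilatedGrad ψ α s i - dilatedGrad ψ α c i) * (u i - s.seq i) =
      -(η * ∑ i, g i * (s.seq i - u i)) + ∑ i, dilatedGrad ψ α s i * (u i - s.seq i) -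
        (∑ i, dilatedGrad ψ α c i * (u i - c.seq i) -
          ∑ i, dilatedGrad ψ α c i * (s.seq i - c.seq i)) := by
    rw [Finset.mul_sum, ← Finset.sum_neg_distrib, ← Finset.sum_add_distrib,
      ← Finset.sum_sub_distrib, ← Finset.sum_sub_distrib]
    exact Finset.sum_congr rfl fun i _ => by ring
  rw [h2] at h1
  simp only [dilatedBregman]
  linarith

end Treeplex

namespace Treeplex

variable {n : ℕ} {T : Treeplex n} {ψ : ∀ h : T.Infoset, (T.Omega h → ℝ) → ℝ} {α : T.Infoset → ℝ}

/-! ### Convexity and continuity of the dilated regularizer -/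

theorem reach_add_smul (x y : Fin n → ℝ) {a b : ℝ} (hab : a + b = 1) (h : T.Infoset) :
    T.reach (a • x + b • y) h = a * T.reach x h + b * T.reach y h := by
  unfold reach
  cases T.parent h <;> simp [hab]

/-- The perspective of a convex function is convex, also with the value `0` at zero reach. -/
theorem convexOn_reach_mul {h : T.Infoset} {f : (T.Omega h → ℝ) → ℝ}
    (hf : ConvexOn ℝ (stdSimplex ℝ (T.Omega h)) f) :
    ConvexOn ℝ T.carrier fun z => T.reach z h * f (fun i => z i.1 / T.reach z h) := by
  refine ⟨T.convex_carrier, fun x hx y hy a b ha hb hab => ?_⟩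
  simp only [smul_eq_mul]
  rw [reach_add_smul x y hab]
  have hrx := mul_nonneg ha (reach_mem_Icc hx h).1
  have hry := mul_nonneg hb (reach_mem_Icc hy h).1
  rcases hrx.eq_or_lt with hx0 | hx0
  · have hax : ∀ i : T.Omega h, a * x i.1 = 0 := fun i => by
      rcases mul_eq_zero.1 hx0.symm with h | h
      · rw [h, zero_mul]
      · rw [eq_zero_of_reach hx h, mul_zero]
    rw [← mul_assoc, ← mul_assoc, ← hx0, zero_add, zero_mul, zero_add]
    rcases hry.eq_or_lt with hy0 | hy0
    · rw [← hy0, zero_mul, zero_mul]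
    · have hb0 : b ≠ 0 := fun h => by simp [h] at hy0
      refine le_of_eq ?_
      congr 2
      funext i
      simp only [Pi.add_apply, Pi.smul_apply, smul_eq_mul, hax i, zero_add]
      rw [mul_div_mul_left _ _ hb0]
  rcases hry.eq_or_lt with hy0 | hy0
  · have hay : ∀ i : T.Omega h, b * y i.1 = 0 := fun i => by
      rcases mul_eq_zero.1 hy0.symm with h | h
      · rw [h, zero_mul]
      · rw [eq_zero_of_reach hy h, mul_zero]
    rw [← mul_assoc, ← mul_assoc, ← hy0, add_zero, zero_mul, add_zero]
    have ha0 : a ≠ 0 := fun h => by simp [h] at hx0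
    refine le_of_eq ?_
    congr 2
    funext i
    simp only [Pi.add_apply, Pi.smul_apply, smul_eq_mul, hay i, add_zero]
    rw [mul_div_mul_left _ _ ha0]
  · have hx1 : 0 < T.reach x h := (pos_iff_pos_of_mul_pos hx0).1
      ((ha.lt_of_ne (fun h => by simp [← h] at hx0)))
    have hy1 : 0 < T.reach y h := (pos_iff_pos_of_mul_pos hy0).1
      ((hb.lt_of_ne (fun h => by simp [← h] at hy0)))
    have h1 := hf.2 (div_reach_mem hx hx1) (div_reach_mem hy hy1)
      (show 0 ≤ a * T.reach x h / (a * T.reach x h + b * T.reach y h) by positivity)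
      (show 0 ≤ b * T.reach y h / (a * T.reach x h + b * T.reach y h) by positivity)
      (by field_simp)
    have h2 := mul_le_mul_of_nonneg_left h1 (add_pos hx0 hy0).le
    simp only [smul_eq_mul] at h2
    refine (le_of_eq ?_).trans (h2.trans_eq ?_)
    · congr 2
      funext i
      simp only [Pi.add_apply, Pi.smul_apply, smul_eq_mul]
      field_simp
    · field_simp

theorem continuous_reach (h : T.Infoset) : Continuous fun z => T.reach z h := by
  unfold reach
  cases T.parent h with
  | none => exact continuous_const
  | some i => exact continuous_apply i

theorem continuousOn_reach_mul {h : T.Infoset} {f : (T.Omega h → ℝ) → ℝ}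
    (hf : ContinuousOn f (stdSimplex ℝ (T.Omega h))) :
    ContinuousOn (fun z => T.reach z h * f (fun i => z i.1 / T.reach z h)) T.carrier := by
  intro z hz
  rcases (reach_mem_Icc hz h).1.eq_or_lt with h0 | h0
  · obtain ⟨K, hK⟩ := (isCompact_stdSimplex ℝ (T.Omega h)).exists_bound_of_continuousOn hf
    rw [ContinuousWithinAt, ← h0, zero_mul]
    refine squeeze_zero_norm' (a := fun z => T.reach z h * K) ?_ ?_
    · filter_upwards [self_mem_nhdsWithin] with w hw
      rcases (reach_mem_Icc hw h).1.eq_or_lt with h1 | h1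
      · simp [← h1]
      · rw [norm_mul, Real.norm_of_nonneg h1.le]
        exact mul_le_mul_of_nonneg_left (hK _ (div_reach_mem hw h1)) h1.le
    · have := (((continuous_reach h).tendsto z).mul_const K).mono_left
        (nhdsWithin_le_nhds (s := T.carrier))
      rwa [← h0, zero_mul] at this
  · have hopen : IsOpen {w : Fin n → ℝ | 0 < T.reach w h} :=
      isOpen_lt continuous_const (continuous_reach h)
    refine ContinuousWithinAt.mono_of_mem_nhdsWithin
      (t := T.carrier ∩ {w | 0 < T.reach w h}) ?_
      (inter_mem_nhdsWithin _ (hopen.mem_nhds h0))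
    refine ContinuousWithinAt.mul (continuous_reach h).continuousWithinAt ?_
    refine (hf _ (div_reach_mem hz h0)).comp (t := stdSimplex ℝ (T.Omega h))
      (f := fun w : Fin n → ℝ => fun i : T.Omega h => w i.1 / T.reach w h) ?_
      (fun w hw => div_reach_mem hw.1 hw.2)
    refine continuousWithinAt_pi.2 fun i => ?_
    exact ((continuous_apply i.1).continuousWithinAt).div (continuous_reach h).continuousWithinAt
      h0.ne'

theorem convexOn_dilated (hψ : ∀ h, IsBaseRegularizer (ψ h)) (hα : ∀ h, 0 ≤ α h) :
    ConvexOn ℝ T.carrier (dilated ψ α) := by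
  refine ⟨T.convex_carrier, fun x hx y hy a b ha hb hab => ?_⟩
  simp only [dilated, smul_eq_mul, Finset.mul_sum, ← Finset.sum_add_distrib]
  refine Finset.sum_le_sum fun h _ => ?_
  obtain ⟨m, hm, hsc⟩ := (hψ h).strongConvexOn
  have h1 := mul_le_mul_of_nonneg_left ((convexOn_reach_mul
    (UniformConvexOn.convexOn hsc fun r => by positivity)).2 hx hy ha hb hab) (hα h)
  simp only [smul_eq_mul] at h1
  rw [mul_assoc]
  exact h1.trans_eq (by ring)

theorem continuousOn_dilated (hψ : ∀ h, IsBaseRegularizer (ψ h)) :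
    ContinuousOn (dilated ψ α) T.carrier := by
  unfold dilated
  refine continuousOn_finsetSum _ fun h _ => ?_
  simp only [mul_assoc]
  exact continuousOn_const.mul (continuousOn_reach_mul (hψ h).continuousOn)

theorem exists_abs_dilated_le (hψ : ∀ h, IsBaseRegularizer (ψ h)) :
    ∃ K, 0 ≤ K ∧ ∀ z ∈ T.carrier, |dilated ψ α z| ≤ K := by
  obtain ⟨K, hK⟩ := T.isCompact_carrier.exists_bound_of_continuousOn
    (continuousOn_dilated (α := α) hψ)
  obtain ⟨z, hz⟩ := T.carrier_nonempty
  exact ⟨K, (norm_nonneg _).trans (hK z hz), hK⟩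

theorem Strategy.IsUniform.loc_eq {s s' : T.Strategy} (hs : s.IsUniform) (hs' : s'.IsUniform) :
    s.loc = s'.loc := funext fun i => (hs i).trans (hs' i).symm

theorem Strategy.IsUniform.loc_pos {s : T.Strategy} (hs : s.IsUniform) (i : Fin n) :
    0 < s.loc i := by
  rw [hs i]
  exact one_div_pos.2 (Nat.cast_pos.2 (Fintype.card_pos_iff.2 ⟨⟨i, rfl⟩⟩))

theorem dilatedGrad_congr {s s' : T.Strategy} (hs : s.loc = s'.loc) :
    dilatedGrad ψ α s = dilatedGrad ψ α s' := by
  have : s.locAt = s'.locAt := by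
    funext h i
    simp only [Strategy.locAt, hs]
  funext i
  simp only [dilatedGrad, this]

/-- The gradient at a uniform strategy only depends on its local strategies, so that the divergence
from it is bounded uniformly over all uniform strategies. -/
theorem exists_dilatedBregman_uniform_le (hψ : ∀ h, IsBaseRegularizer (ψ h)) :
    ∃ B, 0 ≤ B ∧ ∀ s : T.Strategy, s.IsUniform → ∀ z ∈ T.carrier, dilatedBregman ψ α z s ≤ B := by
  by_cases hex : ∃ s : T.Strategy, s.IsUniform
  · obtain ⟨s₀, hs₀⟩ := hex
    obtain ⟨K, hK0, hK⟩ := exists_abs_dilated_le (T := T) (α := α) hψ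
    refine ⟨K + K + ∑ i, |dilatedGrad ψ α s₀ i|, by positivity, fun s hs z hz => ?_⟩
    have h1 := abs_le.1 (hK z hz)
    have h2 := abs_le.1 (hK s.seq s.seq_mem)
    have h3 : -∑ i, dilatedGrad ψ α s i * (z i - s.seq i) ≤ ∑ i, |dilatedGrad ψ α s₀ i| := by
      rw [← Finset.sum_neg_distrib, dilatedGrad_congr (hs.loc_eq hs₀)]
      refine Finset.sum_le_sum fun i _ => ?_
      have h4 := T.mem_Icc_of_mem_carrier z hz i
      have h5 := T.mem_Icc_of_mem_carrier _ s.seq_mem i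
      refine (neg_le_abs _).trans ?_
      rw [abs_mul]
      exact mul_le_of_le_one_right (abs_nonneg _)
        (abs_le.2 ⟨by linarith [h4.1, h5.2], by linarith [h4.2, h5.1]⟩)
    rw [dilatedBregman]
    linarith
  · exact ⟨0, le_rfl, fun s hs => absurd ⟨s, hs⟩ hex⟩

/-- Two uniform strategies have the same sequence form. -/
theorem Strategy.IsUniform.seq_eq_seq (hψ : ∀ h, IsBaseRegularizer (ψ h))
    (hsc : DilatedStronglyConvex ψ α) {s s' : T.Strategy} (hs : s.IsUniform)
    (hs' : s'.IsUniform) : s.seq = s'.seq := by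
  have h1 := hsc s'.seq s'.seq_mem s (differentiableAt_of_pos hψ s hs.loc_pos)
  rw [dilatedBregman_eq_zero] at h1
  · have h2 : ‖WithLp.toLp 2 (s'.seq - s.seq)‖ = 0 := by
      nlinarith [norm_nonneg (WithLp.toLp 2 (s'.seq - s.seq))]
    rw [norm_eq_zero, WithLp.toLp_eq_zero, sub_eq_zero] at h2
    exact h2.symm
  · intro h _
    rw [s'.seq_eq_smul]
    congr 1
    funext i
    simp only [Strategy.locAt, hs.loc_eq hs']

end Treeplex

/-! ### The bilinear form of the game -/

section GameForm

variable {M N : ℕ}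

theorem gameGrad_dotProduct (A : Matrix (Fin M) (Fin N) ℝ) (z w : Fin (M + N) → ℝ) :
    gameGrad A z ⬝ᵥ w = ∑ i, ∑ j, A i j *
      (z (Fin.natAdd M j) * w (Fin.castAdd N i) - z (Fin.castAdd N i) * w (Fin.natAdd M j)) := by
  simp only [gameGrad, dotProduct, Fin.sum_univ_add, Fin.append_left, Fin.append_right,
    Matrix.mulVec, Matrix.transpose_apply, Pi.neg_apply, maxPart, minPart, Finset.sum_mul,
    neg_mul, Finset.sum_neg_distrib]
  rw [Finset.sum_comm (s := Finset.univ (α := Fin N)), ← sub_eq_add_neg,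
    ← Finset.sum_sub_distrib]
  refine Finset.sum_congr rfl fun i _ => ?_
  rw [← Finset.sum_sub_distrib]
  exact Finset.sum_congr rfl fun j _ => by ring

/-- The bilinear form `(z, w) ↦ F(z)ᵀ w`; it is skew-symmetric. -/
def gameForm (A : Matrix (Fin M) (Fin N) ℝ) :
    (Fin (M + N) → ℝ) →ₗ[ℝ] (Fin (M + N) → ℝ) →ₗ[ℝ] ℝ :=
  LinearMap.mk₂ ℝ (fun z w => gameGrad A z ⬝ᵥ w)
    (fun z z' w => by
      simp only [gameGrad_dotProduct, ← Finset.sum_add_distrib, Pi.add_apply]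
      exact Finset.sum_congr rfl fun i _ => Finset.sum_congr rfl fun j _ => by ring)
    (fun c z w => by
      simp only [gameGrad_dotProduct, Finset.mul_sum, Pi.smul_apply, smul_eq_mul]
      exact Finset.sum_congr rfl fun i _ => Finset.sum_congr rfl fun j _ => by ring)
    (fun z w w' => dotProduct_add _ _ _)
    (fun c z w => dotProduct_smul _ _ _)

theorem gameForm_apply (A : Matrix (Fin M) (Fin N) ℝ) (z w : Fin (M + N) → ℝ) :
    gameForm A z w = gameGrad A z ⬝ᵥ w := rfl

theorem gameForm_swap (A : Matrix (Fin M) (Fin N) ℝ) (z w : Fin (M + N) → ℝ) :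
    gameForm A z w = -gameForm A w z := by
  simp only [gameForm_apply, gameGrad_dotProduct, ← Finset.sum_neg_distrib]
  exact Finset.sum_congr rfl fun i _ => Finset.sum_congr rfl fun j _ => by ring

theorem gameForm_self (A : Matrix (Fin M) (Fin N) ℝ) (z : Fin (M + N) → ℝ) :
    gameForm A z z = 0 := by
  linarith [gameForm_swap A z z]

theorem abs_gameForm_le {A : Matrix (Fin M) (Fin N) ℝ} (hA : ∀ i j, |A i j| ≤ 1)
    (z w : Fin (M + N) → ℝ) : |gameForm A z w| ≤ (∑ i, |z i|) * ∑ i, |w i| := by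
  rw [gameForm_apply, gameGrad_dotProduct]
  have h1 : |∑ i, ∑ j, A i j * (z (Fin.natAdd M j) * w (Fin.castAdd N i) -
      z (Fin.castAdd N i) * w (Fin.natAdd M j))| ≤
      ∑ i, ∑ j, (|z (Fin.natAdd M j)| * |w (Fin.castAdd N i)| +
        |z (Fin.castAdd N i)| * |w (Fin.natAdd M j)|) := by
    refine (Finset.abs_sum_le_sum_abs _ _).trans (Finset.sum_le_sum fun i _ => ?_)
    refine (Finset.abs_sum_le_sum_abs _ _).trans (Finset.sum_le_sum fun j _ => ?_)
    rw [abs_mul]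
    refine (mul_le_of_le_one_left (abs_nonneg _) (hA i j)).trans ?_
    refine (abs_sub _ _).trans ?_
    rw [abs_mul, abs_mul]
  refine h1.trans ?_
  have h2 : ∑ i : Fin M, ∑ j : Fin N, (|z (Fin.natAdd M j)| * |w (Fin.castAdd N i)| +
        |z (Fin.castAdd N i)| * |w (Fin.natAdd M j)|) =
      (∑ j : Fin N, |z (Fin.natAdd M j)|) * (∑ i : Fin M, |w (Fin.castAdd N i)|) +
      (∑ i : Fin M, |z (Fin.castAdd N i)|) * (∑ j : Fin N, |w (Fin.natAdd M j)|) := by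
    simp only [Finset.sum_add_distrib]
    rw [Finset.sum_mul_sum, Finset.sum_mul_sum,
      Finset.sum_comm (s := Finset.univ (α := Fin N))]
  rw [h2, Fin.sum_univ_add (fun i => |z i|), Fin.sum_univ_add (fun i => |w i|)]
  have p1 : 0 ≤ ∑ j : Fin N, |z (Fin.natAdd M j)| := Finset.sum_nonneg fun _ _ => abs_nonneg _
  have p2 : 0 ≤ ∑ j : Fin N, |w (Fin.natAdd M j)| := Finset.sum_nonneg fun _ _ => abs_nonneg _
  have p3 : 0 ≤ ∑ i : Fin M, |z (Fin.castAdd N i)| := Finset.sum_nonneg fun _ _ => abs_nonneg _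
  have p4 : 0 ≤ ∑ i : Fin M, |w (Fin.castAdd N i)| := Finset.sum_nonneg fun _ _ => abs_nonneg _
  nlinarith [mul_nonneg p1 p2, mul_nonneg p3 p4]

theorem sq_sum_abs_le {n : ℕ} (v : Fin n → ℝ) :
    (∑ i, |v i|) ^ 2 ≤ n * ‖WithLp.toLp 2 v‖ ^ 2 := by
  rw [EuclideanSpace.norm_sq_eq]
  simpa using sq_sum_le_card_mul_sum_sq (s := Finset.univ) (f := fun i => |v i|)

theorem norm_toLp_le {n : ℕ} (v : Fin n → ℝ) : ‖WithLp.toLp 2 v‖ ≤ n * ‖v‖ := by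
  refine abs_le_of_sq_le_sq' ?_ (by positivity) |>.2
  rw [EuclideanSpace.norm_sq_eq, mul_pow]
  calc ∑ i, ‖v i‖ ^ 2 ≤ ∑ _i : Fin n, ‖v‖ ^ 2 :=
        Finset.sum_le_sum fun i _ => pow_le_pow_left₀ (norm_nonneg _) (norm_le_pi_norm v i) 2
    _ = n * ‖v‖ ^ 2 := by simp
    _ ≤ n ^ 2 * ‖v‖ ^ 2 := by
      gcongr
      exact_mod_cast Nat.le_self_pow two_ne_zero n

theorem abs_gameForm_le_norm {A : Matrix (Fin M) (Fin N) ℝ} (hA : ∀ i j, |A i j| ≤ 1)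
    (z w : Fin (M + N) → ℝ) : |gameForm A z w| ≤
      ((M : ℝ) + N) / 2 * (‖WithLp.toLp 2 z‖ ^ 2 + ‖WithLp.toLp 2 w‖ ^ 2) := by
  have h1 := sq_sum_abs_le z
  have h2 := sq_sum_abs_le w
  push_cast at h1 h2
  nlinarith [abs_gameForm_le hA z w, sq_nonneg (∑ i, |z i| - ∑ i, |w i|)]

variable {X : Treeplex M} {Y : Treeplex N} {A : Matrix (Fin M) (Fin N) ℝ}

theorem gameForm_append (x x' : Fin M → ℝ) (y y' : Fin N → ℝ) :
    gameForm A (Fin.append x y) (Fin.append x' y') =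
      x' ⬝ᵥ A.mulVec y - x ⬝ᵥ A.mulVec y' := by
  rw [gameForm_apply, gameGrad_dotProduct]
  simp only [Fin.append_left, Fin.append_right, dotProduct,
    Matrix.mulVec, Finset.mul_sum, ← Finset.sum_sub_distrib]
  exact Finset.sum_congr rfl fun i _ => Finset.sum_congr rfl fun j _ => by ring

theorem mem_nashSet_iff {z : Fin (M + N) → ℝ} :
    z ∈ nashSet X Y A ↔ z ∈ (X.prod Y).carrier ∧ ∀ w ∈ (X.prod Y).carrier, 0 ≤ gameForm A z w := by
  refine and_congr_right fun hz => ?_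
  obtain ⟨x, hx, y, hy, rfl⟩ := hz
  have h1 : minPart (Fin.append x y) = x := funext fun i => Fin.append_left _ _ _
  have h2 : maxPart (Fin.append x y) = y := funext fun i => Fin.append_right _ _ _
  rw [h1, h2]
  constructor
  · rintro ⟨hmin, hmax⟩ _ ⟨x', hx', y', hy', rfl⟩
    rw [gameForm_append]
    linarith [hmin x' hx', hmax y' hy']
  · intro h
    refine ⟨fun x' hx' => ?_, fun y' hy' => ?_⟩
    · have := h _ ⟨x', hx', y, hy, rfl⟩
      rw [gameForm_append] at this
      linarith
    · have := h _ ⟨x, hx, y', hy', rfl⟩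
      rw [gameForm_append] at this
      linarith

theorem isCompact_nashSet : IsCompact (nashSet X Y A) := by
  have : nashSet X Y A =
      (X.prod Y).carrier ∩ ⋂ w ∈ (X.prod Y).carrier, {z | 0 ≤ gameForm A z w} := by
    ext z
    simp [mem_nashSet_iff]
  rw [this]
  refine (X.prod Y).isCompact_carrier.inter_right (isClosed_biInter fun w _ => ?_)
  exact isClosed_le continuous_const
    (LinearMap.continuous_of_finiteDimensional ((gameForm A).flip w))

/-- The distance to the Nash equilibria is bounded by the duality gap, up to a constant that
depends on the payoff matrix. -/
theorem exists_nashSet_error_bound (X : Treeplex M) (Y : Treeplex N)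
    (A : Matrix (Fin M) (Fin N) ℝ) :
    ∃ C : ℝ, 0 ≤ C ∧ ∀ z ∈ (X.prod Y).carrier, ∀ ε : ℝ, 0 ≤ ε →
      (∀ w ∈ (X.prod Y).carrier, -gameForm A z w ≤ ε) →
      ∃ w, IsEuclideanProj (nashSet X Y A) z w ∧ ‖WithLp.toLp 2 (z - w)‖ ≤ C * ε := by
  obtain ⟨V, hV, -, hVZ⟩ := (X.prod Y).exists_carrier_eq_convexHull
  let g : V → (Fin (M + N) → ℝ) →ₗ[ℝ] ℝ := fun w => -(gameForm A).flip w.1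
  have hg : ∀ z, (∀ j, g j z ≤ 0) ↔ ∀ w ∈ (X.prod Y).carrier, 0 ≤ gameForm A z w := by
    intro z
    constructor
    · intro h
      have : (X.prod Y).carrier ⊆ {w | 0 ≤ gameForm A z w} := by
        rw [hVZ]
        refine convexHull_min (fun w hw => ?_) (convex_halfSpace_ge (gameForm A z).isLinear 0)
        simpa [g] using h ⟨w, hw⟩
      exact this
    · rintro h ⟨w, hw⟩
      simpa [g] using h w (hVZ ▸ subset_convexHull ℝ V hw)
  have := hV.to_subtype
  obtain ⟨u, hu, hu'⟩ := exists_regularized_equilibrium (X.prod Y).carrier_nonempty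
    (X.prod Y).isCompact_carrier (gameForm A) (gameForm_self A) (φ := fun _ => 0)
    (convexOn_const 0 (X.prod Y).convex_carrier) continuousOn_const
  obtain ⟨C, hC, hbound⟩ := exists_error_bound hV g
    ⟨u, hVZ ▸ hu, (hg u).2 fun w hw => by simpa using hu' w hw⟩
  refine ⟨((M + N : ℕ) : ℝ) * C, by positivity, fun z hz ε hε hzε => ?_⟩
  obtain ⟨z', hz', hgz', hd⟩ := hbound z (hVZ ▸ hz) ε hε
    (fun j => by simpa [g] using hzε j.1 (hVZ ▸ subset_convexHull ℝ V j.2))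
  have hz'N : z' ∈ nashSet X Y A := mem_nashSet_iff.2 ⟨hVZ ▸ hz', (hg z').1 hgz'⟩
  have hcont : Continuous fun w : Fin (M + N) → ℝ => ‖WithLp.toLp 2 (z - w)‖ :=
    ((PiLp.continuous_toLp 2 _).comp (continuous_const.sub continuous_id)).norm
  obtain ⟨w, hw, hmin⟩ := isCompact_nashSet.exists_isMinOn ⟨z', hz'N⟩ hcont.continuousOn
  refine ⟨w, ⟨hw, isMinOn_iff.1 hmin⟩, ?_⟩
  calc ‖WithLp.toLp 2 (z - w)‖ ≤ ‖WithLp.toLp 2 (z - z')‖ := isMinOn_iff.1 hmin z' hz'N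
    _ ≤ ((M + N : ℕ) : ℝ) * ‖z - z'‖ := norm_toLp_le _
    _ ≤ ((M + N : ℕ) : ℝ) * C * ε := by
      rw [mul_assoc]
      exact mul_le_mul_of_nonneg_left hd (Nat.cast_nonneg _)

end GameForm

/-! ### Linear convergence within an episode -/

section Episode

open Treeplex

variable {M N : ℕ} {X : Treeplex M} {Y : Treeplex N}
  {ψ : ∀ h : (X.prod Y).Infoset, ((X.prod Y).Omega h → ℝ) → ℝ} {α : (X.prod Y).Infoset → ℝ}
  {A : Matrix (Fin M) (Fin N) ℝ} {η τ : ℝ}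

/-- One iteration contracts the potential `D(u, ẑ) + 7/16 ‖ẑ - z‖²` by the factor `1 - ητ`, for
`u` the regularized equilibrium. Differentiability at `u` is not needed: the regularization term
`τ ⟨∇ψ(ẑ), z - u⟩` is expressed by values of the regularizer and divergences from `ẑ`. -/
theorem mirror_iteration_contracts (hψ : ∀ h, IsBaseRegularizer (ψ h)) (hα : ∀ h, 0 ≤ α h)
    (hsc : DilatedStronglyConvex ψ α) (hη : 0 < η) (hηP : η * ((M : ℝ) + N) ≤ 1 / 8)
    (hA : ∀ i j, |A i j| ≤ 1) (hητ : η * τ ≤ 1 / 8) {u : Fin (M + N) → ℝ}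
    (hu : u ∈ (X.prod Y).carrier)
    (hequ : ∀ z ∈ (X.prod Y).carrier,
      τ * dilated ψ α u ≤ gameForm A u z + τ * dilated ψ α z)
    {p : Fin (M + N) → ℝ} {c s c' : (X.prod Y).Strategy}
    (hc : ∀ h, DifferentiableAt ℝ (ψ h) (c.locAt h))
    (hs : IsMirrorStep ψ α η (fun i => gameGrad A p i + τ * dilatedGrad ψ α c i) c s)
    (hc' : IsMirrorStep ψ α η (fun i => gameGrad A s.seq i + τ * dilatedGrad ψ α c i) c c') :
    dilatedBregman ψ α u c' + 7 / 16 * ‖WithLp.toLp 2 (c'.seq - s.seq)‖ ^ 2 ≤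
      (1 - η * τ) * (dilatedBregman ψ α u c + 7 / 16 * ‖WithLp.toLp 2 (c.seq - p)‖ ^ 2) := by
  have t1 := hc'.three_point hψ hα hη hu
  have t2 := hs.three_point hψ hα hη c'.seq_mem
  have e : ∀ q v w : Fin (M + N) → ℝ,
      ∑ i, (gameGrad A q i + τ * dilatedGrad ψ α c i) * (v i - w i) =
        gameForm A q v - gameForm A q w + τ * ∑ i, dilatedGrad ψ α c i * (v i - w i) := by
    intro q v w
    rw [← map_sub, gameForm_apply, dotProduct, Finset.mul_sum, ← Finset.sum_add_distrib]
    exact Finset.sum_congr rfl fun i _ => by simp only [Pi.sub_apply]; ring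
  rw [e] at t1 t2
  have hg : ∑ i, dilatedGrad ψ α c i * (c'.seq i - u i) +
      ∑ i, dilatedGrad ψ α c i * (s.seq i - c'.seq i) =
      dilated ψ α s.seq - dilated ψ α u - dilatedBregman ψ α s.seq c + dilatedBregman ψ α u c := by
    have : ∑ i, dilatedGrad ψ α c i * (c'.seq i - u i) +
        ∑ i, dilatedGrad ψ α c i * (s.seq i - c'.seq i) =
        ∑ i, dilatedGrad ψ α c i * (s.seq i - c.seq i) -
          ∑ i, dilatedGrad ψ α c i * (u i - c.seq i) := by
      rw [← Finset.sum_add_distrib, ← Finset.sum_sub_distrib]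
      exact Finset.sum_congr rfl fun i _ => by ring
    rw [this, dilatedBregman, dilatedBregman]
    ring
  have hopt := hequ s.seq s.seq_mem
  rw [gameForm_swap] at hopt
  have hskew := gameForm_self A s.seq
  -- the prediction error `⟨F(z_r) - F(z_{r-1}), ẑ_{r+1} - z_r⟩`
  have herr := neg_le_of_abs_le
    (abs_gameForm_le_norm hA (s.seq - p) (c'.seq - s.seq))
  have hsplit : gameForm A (s.seq - p) (c'.seq - s.seq) =
      gameForm A s.seq c'.seq - gameForm A s.seq s.seq - gameForm A p c'.seq +
        gameForm A p s.seq := by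
    simp only [map_sub, LinearMap.sub_apply]
    ring
  rw [hsplit, hskew] at herr
  have htri : ‖WithLp.toLp 2 (s.seq - p)‖ ^ 2 ≤
      2 * ‖WithLp.toLp 2 (s.seq - c.seq)‖ ^ 2 + 2 * ‖WithLp.toLp 2 (c.seq - p)‖ ^ 2 := by
    have h1 : WithLp.toLp 2 (s.seq - p) =
        WithLp.toLp 2 (s.seq - c.seq) + WithLp.toLp 2 (c.seq - p) := by
      rw [← WithLp.toLp_add, sub_add_sub_cancel]
    have h2 := norm_add_le (WithLp.toLp 2 (s.seq - c.seq)) (WithLp.toLp 2 (c.seq - p))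
    rw [← h1] at h2
    have h3 := pow_le_pow_left₀ (norm_nonneg _) h2 2
    nlinarith [sq_nonneg (‖WithLp.toLp 2 (s.seq - c.seq)‖ - ‖WithLp.toLp 2 (c.seq - p)‖)]
  have d1 := hsc s.seq s.seq_mem c hc
  have d2 := hsc c'.seq c'.seq_mem s (hs.differentiableAt hψ hα hsc hη)
  set a := ‖WithLp.toLp 2 (c'.seq - s.seq)‖ ^ 2
  set b := ‖WithLp.toLp 2 (s.seq - p)‖ ^ 2
  set d := ‖WithLp.toLp 2 (s.seq - c.seq)‖ ^ 2
  set f := ‖WithLp.toLp 2 (c.seq - p)‖ ^ 2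
  have ha : 0 ≤ a := by positivity
  have hb : 0 ≤ b := by positivity
  have hd : 0 ≤ d := by positivity
  have hf : 0 ≤ f := by positivity
  have h1 := mul_le_mul_of_nonneg_left herr hη.le
  have h2 := mul_le_mul_of_nonneg_left hopt hη.le
  have h3 : η * (((M : ℝ) + N) / 2 * (b + a)) ≤ 1 / 16 * (b + a) := by
    have := mul_le_mul_of_nonneg_right hηP (add_nonneg hb ha)
    linarith
  have h4 := mul_le_mul_of_nonneg_left d1 (show 0 ≤ 1 - η * τ by linarith)
  have h5 : 7 / 8 * d ≤ (1 - η * τ) * d := mul_le_mul_of_nonneg_right (by linarith) hd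
  have h6 : 7 / 8 * f ≤ (1 - η * τ) * f := mul_le_mul_of_nonneg_right (by linarith) hf
  have h7 : η * (τ * (∑ i, dilatedGrad ψ α c i * (c'.seq i - u i))) +
      η * (τ * ∑ i, dilatedGrad ψ α c i * (s.seq i - c'.seq i)) =
      η * (τ * (dilated ψ α s.seq - dilated ψ α u - dilatedBregman ψ α s.seq c +
        dilatedBregman ψ α u c)) := by
    rw [← hg]
    ring
  rw [mul_add] at t1 t2
  linarith

theorem IsEpisode.differentiableAt {len : ℕ} {z zhat : ℕ → (X.prod Y).Strategy}
    (hψ : ∀ h, IsBaseRegularizer (ψ h)) (hα : ∀ h, 0 ≤ α h)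
    (hsc : DilatedStronglyConvex ψ α) (hη : 0 < η)
    (hep : IsEpisode ψ α A η τ len z zhat) : ∀ r ≤ len, ∀ h,
      DifferentiableAt ℝ (ψ h) ((zhat (r + 1)).locAt h)
  | 0, _ => differentiableAt_of_pos hψ _ hep.init_hat.loc_pos
  | r + 1, hr => (hep.step_hat r hr).differentiableAt hψ hα hsc hη

theorem IsEpisode.dilatedBregman_le {len : ℕ} {z zhat : ℕ → (X.prod Y).Strategy}
    (hψ : ∀ h, IsBaseRegularizer (ψ h)) (hα : ∀ h, 0 ≤ α h)
    (hsc : DilatedStronglyConvex ψ α) (hη : 0 < η) (hηP : η * ((M : ℝ) + N) ≤ 1 / 8)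
    (hA : ∀ i j, |A i j| ≤ 1) (hητ : η * τ ≤ 1 / 8) {u : Fin (M + N) → ℝ}
    (hu : u ∈ (X.prod Y).carrier)
    (hequ : ∀ z ∈ (X.prod Y).carrier,
      τ * dilated ψ α u ≤ gameForm A u z + τ * dilated ψ α z)
    (hep : IsEpisode ψ α A η τ len z zhat) {r : ℕ} (hr : r ≤ len) :
    dilatedBregman ψ α u (zhat (r + 1)) ≤ (1 - η * τ) ^ r * dilatedBregman ψ α u (zhat 1) := by
  have key : ∀ r ≤ len, dilatedBregman ψ α u (zhat (r + 1)) +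
      7 / 16 * ‖WithLp.toLp 2 ((zhat (r + 1)).seq - (z r).seq)‖ ^ 2 ≤
        (1 - η * τ) ^ r * dilatedBregman ψ α u (zhat 1) := by
    intro r
    induction r with
    | zero =>
      intro _
      rw [hep.init_hat.seq_eq_seq hψ hsc hep.init]
      simp
    | succ r ih =>
      intro hr
      refine (mirror_iteration_contracts hψ hα hsc hη hηP hA hητ hu hequ
        (hep.differentiableAt hψ hα hsc hη r (by omega)) (hep.step r hr)
        (hep.step_hat r hr)).trans ?_
      rw [pow_succ' _ r, mul_assoc]
      exact mul_le_mul_of_nonneg_left (ih (by omega)) (by linarith)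
  have := key r hr
  nlinarith [sq_nonneg ‖WithLp.toLp 2 ((zhat (r + 1)).seq - (z r).seq)‖]

theorem one_sub_pow_le_sq_of_burnIn_le (hη : 0 < η) (hτ : 0 < τ) (hητ : η * τ ≤ 1 / 8) {r : ℕ}
    (hr : burnIn η τ ≤ r) : (1 - η * τ) ^ r ≤ τ ^ 2 := by
  have h1 : 2 * Real.log (1 / τ) ≤ η * τ * r := by
    have := mul_le_mul_of_nonneg_left hr (mul_pos hη hτ).le
    rw [burnIn] at this
    refine (le_of_eq ?_).trans this
    field_simp
  calc (1 - η * τ) ^ r ≤ Real.exp (-(η * τ)) ^ r :=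
        pow_le_pow_left₀ (by linarith) (Real.one_sub_le_exp_neg _) r
    _ = Real.exp (-(η * τ * r)) := by rw [← Real.exp_nat_mul]; ring_nf
    _ ≤ Real.exp (2 * Real.log τ) := by
      rw [one_div, Real.log_inv] at h1
      exact Real.exp_le_exp.2 (by linarith)
    _ = τ ^ 2 := by rw [two_mul, Real.exp_add, Real.exp_log hτ, sq]

theorem sum_abs_le_of_mem_carrier {z : Fin (M + N) → ℝ} (hz : z ∈ (X.prod Y).carrier) :
    ∑ i, |z i| ≤ (M : ℝ) + N := by
  calc ∑ i, |z i| ≤ ∑ _i : Fin (M + N), (1 : ℝ) := Finset.sum_le_sum fun i _ => by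
        have := (X.prod Y).mem_Icc_of_mem_carrier z hz i
        rw [abs_of_nonneg this.1]
        exact this.2
    _ = (M : ℝ) + N := by simp

/-- Every point of the treeplex has duality gap at most `(M + N)²`. -/
theorem neg_gameForm_le {z w : Fin (M + N) → ℝ} (hA : ∀ i j, |A i j| ≤ 1)
    (hz : z ∈ (X.prod Y).carrier) (hw : w ∈ (X.prod Y).carrier) :
    -gameForm A z w ≤ ((M : ℝ) + N) ^ 2 := by
  refine (neg_le_abs _).trans ((abs_gameForm_le hA z w).trans ?_)
  rw [sq]
  exact mul_le_mul (sum_abs_le_of_mem_carrier hz) (sum_abs_le_of_mem_carrier hw)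
    (Finset.sum_nonneg fun _ _ => abs_nonneg _) (by positivity)

/-- After the burn-in, the duality gap is of the order of the regularization weight, with a
constant that depends neither on the payoffs nor on the weight. -/
theorem exists_gap_le_of_burnIn_le (hψ : ∀ h, IsBaseRegularizer (ψ h)) (hα : ∀ h, 0 ≤ α h)
    (hsc : DilatedStronglyConvex ψ α) (hη : 0 < η) (hηP : η * ((M : ℝ) + N) ≤ 1 / 8) :
    ∃ G : ℝ, 0 ≤ G ∧ ∀ A : Matrix (Fin M) (Fin N) ℝ, (∀ i j, |A i j| ≤ 1) →
      ∀ τ : ℝ, 0 < τ → τ ≤ 1 → ∀ (len : ℕ) (z zhat : ℕ → (X.prod Y).Strategy),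
      IsEpisode ψ α A η τ len z zhat → ∀ r ≤ len, burnIn η τ ≤ r →
      ∀ w ∈ (X.prod Y).carrier, -gameForm A (zhat (r + 1)).seq w ≤ G * τ := by
  obtain ⟨K, hK0, hK⟩ := exists_abs_dilated_le (T := X.prod Y) (α := α) hψ
  obtain ⟨B, hB0, hB⟩ := exists_dilatedBregman_uniform_le (T := X.prod Y) (α := α) hψ
  set P : ℝ := (M : ℝ) + N with hP
  have hP1 : 1 ≤ P := by
    have : (1 : ℝ) ≤ M := by exact_mod_cast X.pos_dim
    have : (0 : ℝ) ≤ N := Nat.cast_nonneg N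
    linarith
  refine ⟨2 * K + √(2 * P * B) * P, by positivity,
    fun A hA τ hτ hτ1 len z zhat hep r hr hbr w hw => ?_⟩
  have hητ : η * τ ≤ 1 / 8 :=
    (mul_le_mul_of_nonneg_left (hτ1.trans hP1) hη.le).trans hηP
  obtain ⟨u, hu, hequ⟩ := exists_regularized_equilibrium (X.prod Y).carrier_nonempty
    (X.prod Y).isCompact_carrier (gameForm A) (gameForm_self A)
    (φ := fun z => τ * dilated ψ α z)
    (by simpa using (convexOn_dilated (T := X.prod Y) hψ hα).smul hτ.le)
    (continuousOn_const.mul (continuousOn_dilated hψ))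
  have h1 := hep.dilatedBregman_le hψ hα hsc hη hηP hA hητ hu hequ hr
  have h2 : dilatedBregman ψ α u (zhat (r + 1)) ≤ τ ^ 2 * B :=
    h1.trans ((mul_le_mul_of_nonneg_left (hB _ hep.init_hat u hu)
      (pow_nonneg (by linarith) r)).trans (mul_le_mul_of_nonneg_right
        (one_sub_pow_le_sq_of_burnIn_le hη hτ hητ hbr) hB0))
  have h3 := (hsc u hu _ (hep.differentiableAt hψ hα hsc hη r hr)).trans h2
  have h4 : ∑ i, |(u - (zhat (r + 1)).seq) i| ≤ √(2 * P * B) * τ := by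
    refine abs_le_of_sq_le_sq' ?_ (by positivity) |>.2
    rw [mul_pow, Real.sq_sqrt (by positivity)]
    have := sq_sum_abs_le (u - (zhat (r + 1)).seq)
    push_cast at this
    nlinarith
  have h5 : ∑ i, |w i| ≤ P := sum_abs_le_of_mem_carrier hw
  have h6 := (le_abs_self _).trans (abs_gameForm_le hA (u - (zhat (r + 1)).seq) w)
  have h7 : (∑ i, |(u - (zhat (r + 1)).seq) i|) * ∑ i, |w i| ≤ √(2 * P * B) * τ * P :=
    mul_le_mul h4 h5 (Finset.sum_nonneg fun _ _ => abs_nonneg _) (by positivity)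
  rw [map_sub, LinearMap.sub_apply] at h6
  have h8 := hequ w hw
  have h9 := mul_le_mul_of_nonneg_left (abs_le.1 (hK w hw)).2 hτ.le
  have h10 := mul_le_mul_of_nonneg_left (abs_le.1 (hK u hu)).1 hτ.le
  linarith

end Episode

/-! ### The episode lengths -/

section Schedule

variable {η τ₀ c : ℝ} {p : ℕ} {len : ℕ → ℕ}

theorem one_div_weight (τ₀ : ℝ) (k : ℕ) : 1 / weight τ₀ k = 2 ^ k / τ₀ := by
  rw [weight, one_div_div]

theorem weight_pos (hτ : 0 < τ₀) (k : ℕ) : 0 < weight τ₀ k := by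
  unfold weight
  positivity

theorem weight_le_one (hτ : 0 < τ₀) (hτ' : τ₀ ≤ 1) (k : ℕ) : weight τ₀ k ≤ 1 :=
  (div_le_self hτ.le (one_le_pow₀ one_le_two)).trans hτ'

/-- The burn-in of the preceding episode makes the iteration number grow geometrically. -/
theorem IsSchedule.two_pow_le (hlen : IsSchedule η τ₀ c p len) (hη : 0 < η) (hη' : η ≤ 1)
    (hτ : 0 < τ₀) (hτ' : τ₀ ≤ 1) {k r : ℕ} (hr : 1 ≤ r) :
    (2 : ℝ) ^ k ≤ 2 * ((∑ j ∈ Finset.range k, len j + r : ℕ) : ℝ) := by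
  have hr' : (1 : ℝ) ≤ r := by exact_mod_cast hr
  rcases k with _ | _ | k
  · simp
    linarith
  · have : (0 : ℝ) ≤ len 0 := Nat.cast_nonneg _
    simp
    linarith
  · have h1 := (hlen (k + 1)).2.1
    have h2 : (2 : ℝ) ^ (k + 1) ≤ burnIn η (weight τ₀ (k + 1)) := by
      have hlog : 1 / 2 ≤ Real.log (1 / weight τ₀ (k + 1)) := by
        have h3 : (2 : ℝ) ≤ 1 / weight τ₀ (k + 1) := by
          rw [one_div_weight, le_div_iff₀ hτ, pow_succ]
          nlinarith [one_le_pow₀ (n := k) (one_le_two (α := ℝ))]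
        have h4 := Real.log_le_log two_pos h3
        linarith [Real.log_two_gt_d9]
      have h5 : 2 * 2 ^ (k + 1) ≤ 2 / (η * weight τ₀ (k + 1)) := by
        rw [← mul_one_div, ← one_div_mul_one_div, one_div_weight]
        refine mul_le_mul_of_nonneg_left ?_ two_pos.le
        have h6 : 1 ≤ 1 / η := (one_le_div hη).2 hη'
        have h7 : (2 : ℝ) ^ (k + 1) ≤ 2 ^ (k + 1) / τ₀ := (le_div_iff₀ hτ).2
          (mul_le_of_le_one_right (by positivity) hτ')
        exact h7.trans (le_mul_of_one_le_left (by positivity) h6)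
      calc (2 : ℝ) ^ (k + 1) = 2 * 2 ^ (k + 1) * (1 / 2) := by ring
        _ ≤ _ := mul_le_mul h5 hlog (by norm_num) ((by positivity : (0 : ℝ) ≤ _).trans h5)
    have h3 : len (k + 1) ≤ ∑ j ∈ Finset.range (k + 1 + 1), len j + r :=
      (Finset.single_le_sum (f := len) (fun _ _ => Nat.zero_le _)
        (Finset.mem_range.2 (Nat.lt_succ_self _))).trans (Nat.le_add_right _ _)
    have h4 : (len (k + 1) : ℝ) ≤ ((∑ j ∈ Finset.range (k + 1 + 1), len j + r : ℕ) : ℝ) := by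
      exact_mod_cast h3
    rw [pow_succ]
    linarith

/-- The regularization weight in terms of the iteration number. -/
theorem IsSchedule.weight_le (hlen : IsSchedule η τ₀ c p len) (hη : 0 < η) (hη' : η ≤ 1)
    (hτ : 0 < τ₀) (hτ' : τ₀ ≤ 1) {k r t : ℕ} (hr : 1 ≤ r) (hrk : r ≤ len k)
    (ht : t = ∑ j ∈ Finset.range k, len j + r) :
    weight τ₀ k ≤ 2 * c * (1 + Real.log (2 / τ₀)) ^ p * (1 + Real.log t) ^ p / t := by
  have ht1 : (1 : ℝ) ≤ t := by
    exact_mod_cast (show 1 ≤ t by omega)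
  have h1 := hlen.two_pow_le hη hη' hτ hτ' (k := k) hr
  rw [← ht] at h1
  set ℓ : ℕ → ℝ := fun j => 1 + Real.log (1 / weight τ₀ j)
  have hmono : ∀ j ≤ k, ℓ j ≤ ℓ k := by
    intro j hj
    have : Real.log (1 / weight τ₀ j) ≤ Real.log (1 / weight τ₀ k) := by
      rw [one_div_weight, one_div_weight]
      refine Real.log_le_log (by positivity) ?_
      gcongr
      norm_num
    simp only [ℓ]
    linarith
  have hℓ1 : ∀ j, 1 ≤ ℓ j := fun j => by
    have : 0 ≤ Real.log (1 / weight τ₀ j) :=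
      Real.log_nonneg ((one_le_div (weight_pos hτ j)).2 (weight_le_one hτ hτ' j))
    simpa [ℓ] using this
  have hc : 0 < c := by
    have h2 : (1 : ℝ) ≤ len 0 := by exact_mod_cast (hlen 0).1
    have h3 := h2.trans (hlen 0).2.2
    by_contra hc
    have h4 : c / weight τ₀ 0 ≤ 0 := div_nonpos_of_nonpos_of_nonneg (not_lt.1 hc)
      (weight_pos hτ 0).le
    have h5 : 0 ≤ (1 + Real.log (1 / weight τ₀ 0)) ^ p :=
      pow_nonneg (zero_le_one.trans (hℓ1 0)) p
    linarith [mul_nonpos_of_nonpos_of_nonneg h4 h5]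
  have hsum : ∀ m ≤ k + 1, ((∑ j ∈ Finset.range m, len j : ℕ) : ℝ) ≤
      c * ℓ k ^ p * (2 ^ m / τ₀) := by
    intro m
    have hℓk : 0 ≤ ℓ k ^ p := pow_nonneg (zero_le_one.trans (hℓ1 k)) p
    induction m with
    | zero =>
      intro _
      simp
      positivity
    | succ m ih =>
      intro hm
      rw [Finset.sum_range_succ, Nat.cast_add]
      have h2 : (len m : ℝ) ≤ c * ℓ k ^ p * (2 ^ m / τ₀) := by
        refine (hlen m).2.2.trans ?_
        have h3 : c / weight τ₀ m = c * (2 ^ m / τ₀) := by rw [← one_div_weight, mul_one_div]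
        rw [h3]
        calc c * (2 ^ m / τ₀) * ℓ m ^ p ≤ c * (2 ^ m / τ₀) * ℓ k ^ p := by
              gcongr
              · exact zero_le_one.trans (hℓ1 m)
              · exact hmono m (by omega)
          _ = c * ℓ k ^ p * (2 ^ m / τ₀) := by ring
      have h3 := ih (by omega)
      have h4 : c * ℓ k ^ p * (2 ^ (m + 1) / τ₀) =
        c * ℓ k ^ p * (2 ^ m / τ₀) + c * ℓ k ^ p * (2 ^ m / τ₀) := by ring
      linarith
  have htk : (t : ℝ) ≤ c * ℓ k ^ p * (2 ^ (k + 1) / τ₀) := by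
    refine le_trans ?_ (hsum (k + 1) le_rfl)
    rw [ht, Finset.sum_range_succ]
    exact_mod_cast Nat.add_le_add_left hrk _
  have hlogt : 0 ≤ Real.log t := Real.log_nonneg ht1
  have hloga : 0 ≤ Real.log (2 / τ₀) := Real.log_nonneg ((one_le_div hτ).2 (by linarith))
  have hℓk : ℓ k ≤ (1 + Real.log (2 / τ₀)) * (1 + Real.log t) := by
    have h2 : Real.log (1 / weight τ₀ k) ≤ Real.log (2 / τ₀) + Real.log t := by
      rw [← Real.log_mul (by positivity) (by positivity), one_div_weight]
      refine Real.log_le_log (by positivity) ?_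
      rw [div_mul_eq_mul_div]
      gcongr
    simp only [ℓ]
    nlinarith [mul_nonneg hloga hlogt]
  rw [le_div_iff₀ (by linarith)]
  calc weight τ₀ k * t ≤ weight τ₀ k * (c * ℓ k ^ p * (2 ^ (k + 1) / τ₀)) :=
        mul_le_mul_of_nonneg_left htk (weight_pos hτ k).le
    _ = 2 * c * ℓ k ^ p := by
      rw [weight]
      field_simp
      ring
    _ ≤ 2 * c * ((1 + Real.log (2 / τ₀)) * (1 + Real.log t)) ^ p := by
      gcongr
      exact zero_le_one.trans (hℓ1 k)
    _ = _ := by rw [mul_pow, mul_assoc]; ring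

end Schedule

end

/-! ### The convergence rate -/

theorem theorem2 {M N : ℕ} (X : Treeplex M) (Y : Treeplex N)
    (ψ : ∀ h : (X.prod Y).Infoset, ((X.prod Y).Omega h → ℝ) → ℝ)
    (α : (X.prod Y).Infoset → ℝ)
    (hψ : ∀ h, IsBaseRegularizer (ψ h)) (hα : ∀ h, 0 ≤ α h)
    (hsc : Treeplex.DilatedStronglyConvex ψ α)
    (η τ₀ c : ℝ) (p : ℕ) (hη : 0 < η) (hη' : η ≤ 1 / (8 * ((M : ℝ) + N)))
    (hτ : 0 < τ₀) (hτ' : τ₀ ≤ 1) :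
    -- the constant of the duality gap does not depend on the payoff matrix
    ∃ C : ℝ, ∀ A : Matrix (Fin M) (Fin N) ℝ, (∀ i j, |A i j| ≤ 1) →
    ∃ C' : ℝ, ∀ len : ℕ → ℕ, IsSchedule η τ₀ c p len →
    ∀ z zhat : ℕ → ℕ → (X.prod Y).Strategy,
    (∀ k, IsEpisode ψ α A η (weight τ₀ k) (len k) (z k) (zhat k)) →
    -- iteration `r` of episode `k` is iteration number `t` of the whole run
    ∀ k r t : ℕ, 1 ≤ r → r ≤ len k → t = ∑ j ∈ Finset.range k, len j + r →
    ∀ s : (X.prod Y).Strategy,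
    -- `s` is the current iterate, or the last iterate of the previous episode
    ((s = zhat k (r + 1) ∧ (k = 0 ∨ burnIn η (weight τ₀ k) ≤ r)) ∨
      (∃ k', k = k' + 1 ∧ s = zhat k' (len k' + 1))) →
    dualityGap X Y A s.seq ≤ C * (1 + Real.log t) ^ p / t ∧
    ∃ w, IsEuclideanProj (nashSet X Y A) s.seq w ∧
      ‖WithLp.toLp 2 (s.seq - w)‖ ≤ C' * (1 + Real.log t) ^ p / t := by
  have hM : (1 : ℝ) ≤ M := by exact_mod_cast X.pos_dim
  have hN : (0 : ℝ) ≤ N := Nat.cast_nonneg N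
  have hηP : η * ((M : ℝ) + N) ≤ 1 / 8 := by
    have := mul_le_mul_of_nonneg_right hη' (show 0 ≤ (M : ℝ) + N by linarith)
    refine this.trans_eq ?_
    field_simp
  have hη1 : η ≤ 1 := by nlinarith
  obtain ⟨G, hG0, hG⟩ := exists_gap_le_of_burnIn_le hψ hα hsc hη hηP
  -- the second summand covers the burn-in of episode `0`, where only the trivial bound is available
  set G' : ℝ := 2 * G + ((M : ℝ) + N) ^ 2 / τ₀ with hG'
  have hG'0 : 0 ≤ G' := by positivity
  refine ⟨G' * (2 * c * (1 + Real.log (2 / τ₀)) ^ p), fun A hA => ?_⟩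
  obtain ⟨D, hD0, hD⟩ := exists_nashSet_error_bound X Y A
  refine ⟨D * (G' * (2 * c * (1 + Real.log (2 / τ₀)) ^ p)),
    fun len hlen z zhat hep k r t hr hrk ht s hs => ?_⟩
  have hw0 := weight_pos hτ k
  have hgap : ∀ w ∈ (X.prod Y).carrier, -gameForm A s.seq w ≤ G' * weight τ₀ k := by
    intro w hw
    have hGw : 2 * G * weight τ₀ k ≤ G' * weight τ₀ k :=
      mul_le_mul_of_nonneg_right (le_add_of_nonneg_right (by positivity)) hw0.le
    have hGw0 := mul_nonneg hG0 hw0.le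
    rcases hs with ⟨rfl, rfl | hb⟩ | ⟨k', rfl, rfl⟩
    · refine (neg_gameForm_le hA (zhat 0 (r + 1)).seq_mem hw).trans ?_
      have h0 : weight τ₀ 0 = τ₀ := by simp [weight]
      have h1 : ((M : ℝ) + N) ^ 2 = ((M : ℝ) + N) ^ 2 / τ₀ * τ₀ := by field_simp
      rw [h0, hG', add_mul, ← h1]
      exact le_add_of_nonneg_left (by positivity)
    · have := hG A hA _ hw0 (weight_le_one hτ hτ' k) _ _ _ (hep k) r hrk hb w hw
      linarith
    · have h1 := hG A hA _ (weight_pos hτ k') (weight_le_one hτ hτ' k') _ _ _ (hep k') (len k')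
        le_rfl (hlen k').2.1 w hw
      have h2 : weight τ₀ k' = 2 * weight τ₀ (k' + 1) := by
        rw [weight, weight, pow_succ]
        field_simp
      rw [h2] at h1
      linarith
  have hwt := mul_le_mul_of_nonneg_left (hlen.weight_le hη hη1 hτ hτ' hr hrk ht) hG'0
  have hrate : G' * weight τ₀ k ≤
      G' * (2 * c * (1 + Real.log (2 / τ₀)) ^ p) * (1 + Real.log t) ^ p / t :=
    hwt.trans_eq (by ring)
  refine ⟨?_, ?_⟩
  · refine csSup_le ((X.prod Y).carrier_nonempty.image _) ?_
    rintro _ ⟨w, hw, rfl⟩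
    refine le_trans (le_of_eq ?_) ((hgap w hw).trans hrate)
    change gameGrad A s.seq ⬝ᵥ (s.seq - w) = _
    rw [← gameForm_apply, map_sub, gameForm_self, zero_sub]
  · obtain ⟨w, hw, hdist⟩ := hD s.seq s.seq_mem _ (mul_nonneg hG'0 hw0.le) hgap
    refine ⟨w, hw, hdist.trans ((mul_le_mul_of_nonneg_left hrate hD0).trans_eq ?_)⟩
    ring
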